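/- Let $\epsilon$ be a bounded real random variable with $\mathbb{E}\,\epsilon = 0$, $\operatorname{Var}(\epsilon) = 1$ and $\mathbb{E}\,\epsilon^3 = 0$. Then there exists a constant $\theta_1 > 0$ such that, for every integer $n \ge 1$, one can construct on a common probability space independent random variables $\epsilon_1, \dots, \epsilon_n$, each distributed as $\epsilon$, and a random variable $Z_n \sim \mathcal{N}(0,n)$ such that, with $S_n = \sum_{i=1}^n \epsilon_i$, $$\mathbb{E} \exp\left(\theta_1 |S_n - Z_n|\right) \le 8.$$ -/

import Mathlib

open MeasureTheory ProbabilityTheory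

/-!
The sum `S` of `n` copies is coupled with a Gaussian variable by the quantile transform, and the
bound `|S - √n N| ≤ K (1 + N²)` is proved with `N` standard normal and `K` depending only on the
bound for the summands. The exponential moment then follows by integrating `exp (N² / 4)`.

For the quantile bound, normalise to `W = S / √n` and let `T` be the same sum with one summand
replaced by a variable with its zero-bias law. With `B` a bound for the summands,
`|W - T| ≤ δ = 2 B / √n`, and `T` has the density `p x = E[W; W > x]`
(`upperMoment_convPow`). Put `A x = E[T; T > x]`. Closeness of `W` and `T` gives a Harnack
inequality for `p` at scale `δ` (`ZeroBiasPair.harnack`), and with it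
`A x = p x (1 + O(δ (1 + x)))` for `x` up to order `1 / δ`. As `A' = -x p`, integrating this
differential inequality yields `p x = p 0 exp (-x² / 2 + O(δ (1 + x³)))`
(`ZeroBiasPair.p_le_exp`, `ZeroBiasPair.exp_le_p`). The total mass of `p` determines `p 0` up to a
factor `1 + O(δ)` and gives a Berry–Esseen bound (`ZeroBiasPair.berryEsseen`). Near the origin that
bound, and farther out the comparison of `p` with the Gaussian density after the change of variables
`y ↦ y ± C δ (1 + y²)`, trap the tail of `T` between two shifted Gaussian tails
(`ZeroBiasPair.tail_comparison`). Inverting tails gives the bound on quantiles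
(`ZeroBiasPair.abs_quantile_sub_le`), whose range of validity is extended to all levels by the
trivial bound `|W| ≤ n B / √n`.

The one-dimensional coupling is lifted to the individual summands by disintegration
(`exists_glue`).
-/

/-! ### Zero-bias pairs and a Harnack inequality -/

/-- A random variable `W` together with a `δ`-close random variable `T` which has the zero-bias law
of `W`: its density is `p x = E[W; W > x]`. Only what the upper half-line needs is recorded. There
`p x` is merely squeezed between `E[W; W > x]` and `E[W; W ≥ x]`, so that `-W`, `-T`, `x ↦ p (-x)`
form such a pair as well although `p` may jump at the atoms of `W`; on the whole line only `p ≤ p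
0` is kept. The variance of `W` is `1`, because `p` has total mass `1`. -/
structure ZeroBiasPair {Ω : Type*} [MeasurableSpace Ω] (P : Measure Ω) (W T : Ω → ℝ) (p : ℝ → ℝ)
    (δ : ℝ) : Prop where
  measW : Measurable W
  measT : Measurable T
  pos : 0 < δ
  close : ∀ᵐ ω ∂P, |W ω - T ω| ≤ δ
  bdd : ∃ M, ∀ᵐ ω ∂P, |W ω| ≤ M
  p_meas : Measurable p
  p_nonneg : ∀ x, 0 ≤ p x
  p_le : ∀ x, p x ≤ p 0
  low : ∀ x, 0 ≤ x → ∫ ω in {ω | x < W ω}, W ω ∂P ≤ p x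
  up : ∀ x, 0 ≤ x → p x ≤ ∫ ω in {ω | x ≤ W ω}, W ω ∂P
  law : P.map T = volume.withDensity (fun x => ENNReal.ofReal (p x))

namespace ZeroBiasPair

variable {Ω : Type*} [MeasurableSpace Ω] {P : Measure Ω}
  {W T : Ω → ℝ} {p : ℝ → ℝ} {δ : ℝ}

/-- `x ↦ p (max x 0)` is an antitone majorant of `p` on the whole line. It spares a separate
treatment of intervals that reach below `0`. -/
lemma p_le_max (h : ZeroBiasPair P W T p δ) (x : ℝ) : p x ≤ p (max x 0) := by
  rcases le_total x 0 with hx | hx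
  · rw [max_eq_right hx]; exact h.p_le x
  · rw [max_eq_left hx]

lemma real_T_mem (h : ZeroBiasPair P W T p δ) {s : Set ℝ} (hs : MeasurableSet s) :
    P.real {ω | T ω ∈ s} = ∫ x in s, p x := by
  have : P {ω | T ω ∈ s} = ∫⁻ x in s, ENNReal.ofReal (p x) := by
    rw [← withDensity_apply _ hs, ← h.law, Measure.map_apply h.measT hs]; rfl
  rw [Measure.real, this, integral_eq_lintegral_of_nonneg_ae (ae_of_all _ h.p_nonneg)
    h.p_meas.aestronglyMeasurable]

lemma real_T_gt (h : ZeroBiasPair P W T p δ) (u : ℝ) :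
    P.real {ω | u < T ω} = ∫ x in Set.Ioi u, p x :=
  h.real_T_mem measurableSet_Ioi

variable [IsProbabilityMeasure P]

lemma intW (h : ZeroBiasPair P W T p δ) : Integrable W P := by
  obtain ⟨M, hM⟩ := h.bdd
  exact Integrable.of_bound h.measW.aestronglyMeasurable M (by simpa using hM)

lemma intT (h : ZeroBiasPair P W T p δ) : Integrable T P := by
  obtain ⟨M, hM⟩ := h.bdd
  refine Integrable.of_bound h.measT.aestronglyMeasurable (M + δ) ?_
  filter_upwards [hM, h.close] with ω h1 h2
  rw [Real.norm_eq_abs]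
  rw [abs_le] at *
  constructor <;> linarith

lemma lintegral_p (h : ZeroBiasPair P W T p δ) : ∫⁻ x, ENNReal.ofReal (p x) = 1 := by
  have := congrArg (fun μ => μ Set.univ) h.law
  simp only [withDensity_apply _ MeasurableSet.univ, Measure.restrict_univ] at this
  rw [← this, Measure.map_apply h.measT MeasurableSet.univ]
  simp

lemma integrable_p (h : ZeroBiasPair P W T p δ) : Integrable p := by
  refine ⟨h.p_meas.aestronglyMeasurable, ?_⟩
  rw [hasFiniteIntegral_iff_ofReal (ae_of_all _ h.p_nonneg), h.lintegral_p]
  simp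

lemma integral_p (h : ZeroBiasPair P W T p δ) : ∫ x, p x = 1 := by
  rw [integral_eq_lintegral_of_nonneg_ae (ae_of_all _ h.p_nonneg)
    h.p_meas.aestronglyMeasurable, h.lintegral_p]
  simp

lemma tail_sub_tail (h : ZeroBiasPair P W T p δ) (u v : ℝ) :
    P.real {ω | u < T ω} - P.real {ω | v < T ω} = ∫ x in u..v, p x := by
  rw [h.real_T_gt, h.real_T_gt]
  rw [intervalIntegral.integral_Ioi_sub_Ioi' h.integrable_p.integrableOn
    h.integrable_p.integrableOn]

lemma intervalIntegrable_p (h : ZeroBiasPair P W T p δ) (u v : ℝ) :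
    IntervalIntegrable p volume u v := h.integrable_p.intervalIntegrable

lemma real_W_gt_le (h : ZeroBiasPair P W T p δ) (u : ℝ) :
    P.real {ω | u < W ω} ≤ P.real {ω | u - δ < T ω} := by
  refine ENNReal.toReal_mono (measure_ne_top _ _) (measure_mono_ae ?_)
  filter_upwards [h.close] with ω h1 h2
  have h2 : u < W ω := h2
  show u - δ < T ω
  have := (abs_le.1 h1).2
  linarith

lemma real_T_gt_le (h : ZeroBiasPair P W T p δ) (u : ℝ) :
    P.real {ω | u < T ω} ≤ P.real {ω | u - δ < W ω} := by
  refine ENNReal.toReal_mono (measure_ne_top _ _) (measure_mono_ae ?_)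
  filter_upwards [h.close] with ω h1 h2
  have h2 : u < T ω := h2
  show u - δ < W ω
  have := (abs_le.1 h1).1
  linarith

lemma real_W_Icc_le (h : ZeroBiasPair P W T p δ) {u v : ℝ} (huv : u ≤ v) :
    P.real {ω | W ω ∈ Set.Icc u v} ≤ ∫ x in (u - δ)..(v + δ), p x := by
  have hp := h.pos
  have : P.real {ω | T ω ∈ Set.Icc (u - δ) (v + δ)} = ∫ x in (u - δ)..(v + δ), p x := by
    rw [h.real_T_mem measurableSet_Icc, intervalIntegral.integral_of_le (by linarith),
      integral_Icc_eq_integral_Ioc]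
  rw [← this]
  refine ENNReal.toReal_mono (measure_ne_top _ _) (measure_mono_ae ?_)
  filter_upwards [h.close] with ω h1 h2
  have h2 : W ω ∈ Set.Icc u v := h2
  show T ω ∈ Set.Icc (u - δ) (v + δ)
  have := abs_le.1 h1
  exact ⟨by linarith [h2.1], by linarith [h2.2]⟩

lemma intOn_gt (h : ZeroBiasPair P W T p δ) {x y : ℝ} (hx : 0 ≤ x) (hxy : x < y) :
    ∫ ω in {ω | y ≤ W ω}, W ω ∂P ≤ ∫ ω in {ω | x < W ω}, W ω ∂P := by
  refine setIntegral_mono_set h.intW.integrableOn ?_ ?_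
  · refine (ae_restrict_iff' (measurableSet_lt measurable_const h.measW)).2 (ae_of_all _ ?_)
    intro ω hω
    have : x < W ω := hω
    show 0 ≤ W ω
    linarith
  · refine ae_of_all _ ?_
    intro ω hω
    have : y ≤ W ω := hω
    show x < W ω
    linarith

lemma anti (h : ZeroBiasPair P W T p δ) {x y : ℝ} (hx : 0 ≤ x) (hxy : x ≤ y) : p y ≤ p x := by
  rcases hxy.eq_or_lt with rfl | hlt
  · rfl
  · exact (h.up y (by linarith)).trans ((h.intOn_gt hx hlt).trans (h.low x hx))

lemma anti_max (h : ZeroBiasPair P W T p δ) : Antitone (fun x => p (max x 0)) := by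
  intro x y hxy
  exact h.anti (le_max_right _ _) (max_le_max_right 0 hxy)

lemma intervalIntegral_p_le (h : ZeroBiasPair P W T p δ) {u v : ℝ} (huv : u ≤ v) :
    ∫ x in u..v, p x ≤ (v - u) * p (max u 0) := by
  have : ∫ x in u..v, p x ≤ ∫ x in u..v, p (max u 0) := by
    refine intervalIntegral.integral_mono_on huv (h.intervalIntegrable_p _ _) (by simp) ?_
    intro x hx
    exact (h.p_le_max x).trans (h.anti_max hx.1)
  simpa using this

/-- `p x - p y` is at most `E[W; x ≤ W ≤ y] ≤ y P(x ≤ W ≤ y)`, and that probability is controlled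
by the density of `T` on a slightly larger interval: a delayed version of `-p' ≤ y p`. -/
lemma increment_le (h : ZeroBiasPair P W T p δ) {x y : ℝ} (hx : 0 ≤ x) (hxy : x ≤ y) :
    p x - p y ≤ y * ∫ t in (x - δ)..(y + δ), p t := by
  have h1 : p x - p y ≤ ∫ ω in {ω | x ≤ W ω}, W ω ∂P - ∫ ω in {ω | y < W ω}, W ω ∂P :=
    sub_le_sub (h.up x hx) (h.low y (by linarith))
  have m1 : MeasurableSet {ω | x ≤ W ω} := measurableSet_le measurable_const h.measW
  have m2 : MeasurableSet {ω | y < W ω} := measurableSet_lt measurable_const h.measW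
  have m3 : MeasurableSet {ω | W ω ∈ Set.Icc x y} := h.measW measurableSet_Icc
  have h2 : ∫ ω in {ω | x ≤ W ω}, W ω ∂P - ∫ ω in {ω | y < W ω}, W ω ∂P
      = ∫ ω in {ω | W ω ∈ Set.Icc x y}, W ω ∂P := by
    have : {ω | x ≤ W ω} = {ω | y < W ω} ∪ {ω | W ω ∈ Set.Icc x y} := by
      ext ω
      simp only [Set.mem_ofPred_eq, Set.mem_union, Set.mem_Icc]
      constructor
      · intro hh
        rcases lt_or_ge y (W ω) with h3 | h3
        · exact Or.inl h3
        · exact Or.inr ⟨hh, h3⟩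
      · rintro (h3 | h3)
        · linarith
        · exact h3.1
    rw [this, setIntegral_union ?_ m3 h.intW.integrableOn h.intW.integrableOn]
    · ring
    · rw [Set.disjoint_left]
      intro ω h3 h4
      have h3 : y < W ω := h3
      exact absurd h4.2 (not_le.2 h3)
  have h3 : ∫ ω in {ω | W ω ∈ Set.Icc x y}, W ω ∂P ≤ ∫ ω in {ω | W ω ∈ Set.Icc x y}, y ∂P := by
    refine setIntegral_mono_on h.intW.integrableOn (by simp) m3 ?_
    intro ω hω
    exact hω.2
  have h4 : ∫ ω in {ω | W ω ∈ Set.Icc x y}, y ∂P = y * P.real {ω | W ω ∈ Set.Icc x y} := by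
    rw [setIntegral_const, smul_eq_mul, mul_comm]
  have h5 := mul_le_mul_of_nonneg_left (h.real_W_Icc_le hxy) (hx.trans hxy)
  linarith

lemma max_sub_sub_le (h : ZeroBiasPair P W T p δ) {x : ℝ} (hx : 0 < x) :
    p (max (x - δ) 0) - p x ≤ 3 * δ * x * p (max (x - 2 * δ) 0) := by
  have hp := h.pos
  have h1 := h.increment_le (le_max_right (x - δ) 0)
    (show max (x - δ) 0 ≤ x from max_le (by linarith) hx.le)
  have h2 := h.intervalIntegral_p_le (u := max (x - δ) 0 - δ) (v := x + δ)
    (by have : max (x - δ) 0 ≤ x := max_le (by linarith) hx.le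
        linarith)
  have h3 : x - δ ≤ max (x - δ) 0 := le_max_left _ _
  have h4 : p (max (max (x - δ) 0 - δ) 0) ≤ p (max (x - 2 * δ) 0) := h.anti_max (by linarith)
  have h5 : (x + δ - (max (x - δ) 0 - δ)) * p (max (max (x - δ) 0 - δ) 0)
      ≤ 3 * δ * p (max (x - 2 * δ) 0) :=
    mul_le_mul (by linarith) h4 (h.p_nonneg _) (by linarith)
  have h6 := mul_le_mul_of_nonneg_left (h2.trans h5) hx.le
  linarith

/-- Harnack inequality at scale `δ`: as long as `x δ` is small, `p` does at most double when its
argument moves left by `δ`. The delayed inequality `max_sub_sub_le` is propagated along a grid of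
mesh `δ`, starting from the half-line `x ≤ 0` where both sides equal `p 0`. -/
lemma harnack (h : ZeroBiasPair P W T p δ) {x : ℝ} (hx : x * δ ≤ 1 / 12) :
    p (max (x - δ) 0) ≤ 2 * p (max x 0) := by
  have hp := h.pos
  have key : ∀ k : ℕ, ∀ x : ℝ, x ≤ k * δ → x * δ ≤ 1 / 12 →
      p (max (x - δ) 0) ≤ 2 * p (max x 0) := by
    intro k
    induction k with
    | zero =>
      intro x hx _
      simp only [CharP.cast_eq_zero, zero_mul] at hx
      rw [max_eq_right hx, max_eq_right (by linarith)]
      linarith [h.p_nonneg 0]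
    | succ k ih =>
      intro x hx hx2
      push_cast at hx
      rcases le_or_gt x 0 with h0 | h0
      · rw [max_eq_right h0, max_eq_right (by linarith)]
        linarith [h.p_nonneg 0]
      · have h1 := ih (x - δ) (by linarith) (by nlinarith)
        have h2 := h.max_sub_sub_le h0
        rw [show x - δ - δ = x - 2 * δ by ring] at h1
        rw [max_eq_left h0.le]
        have h3 : 3 * δ * x * p (max (x - 2 * δ) 0) ≤ 3 * δ * x * (2 * p (max (x - δ) 0)) :=
          mul_le_mul_of_nonneg_left h1 (by positivity)
        have h4 : 6 * (x * δ) * p (max (x - δ) 0) ≤ 1 / 2 * p (max (x - δ) 0) :=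
          mul_le_mul_of_nonneg_right (by linarith) (h.p_nonneg _)
        linarith
  obtain ⟨k, hk⟩ := exists_nat_ge (x / δ)
  exact key k x ((div_le_iff₀ hp).1 hk) hx

lemma harnack_two (h : ZeroBiasPair P W T p δ) {x : ℝ} (hx : x * δ ≤ 1 / 12) :
    p (max (x - 2 * δ) 0) ≤ 4 * p (max x 0) := by
  have hp := h.pos
  have h1 := h.harnack hx
  have h2 := h.harnack (x := x - δ) (by nlinarith)
  rw [show x - δ - δ = x - 2 * δ by ring] at h2
  linarith

lemma mul_real_W_gt_le (h : ZeroBiasPair P W T p δ) {x : ℝ} (hx : 0 ≤ x) :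
    x * P.real {ω | x < W ω} ≤ p x := by
  have m2 : MeasurableSet {ω | x < W ω} := measurableSet_lt measurable_const h.measW
  have h3 : ∫ ω in {ω | x < W ω}, x ∂P ≤ ∫ ω in {ω | x < W ω}, W ω ∂P := by
    refine setIntegral_mono_on (by simp) h.intW.integrableOn m2 ?_
    intro ω hω
    exact le_of_lt hω
  rw [setIntegral_const, smul_eq_mul, mul_comm] at h3
  exact h3.trans (h.low x hx)

/-- The tail of `W` is dominated by the density: `W ∈ [x - δ, x + 1]` is controlled by the Harnack
inequality, and `W > x + 1` by Markov's inequality. -/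
lemma real_W_gt_sub_le (h : ZeroBiasPair P W T p δ) (hδ : δ ≤ 1 / 3) {x : ℝ} (hx0 : 0 ≤ x)
    (hx : x * δ ≤ 1 / 12) : P.real {ω | x - δ < W ω} ≤ 9 * p x := by
  have hp := h.pos
  have h1 : P.real {ω | x - δ < W ω} ≤
      P.real {ω | W ω ∈ Set.Icc (x - δ) (x + 1)} + P.real {ω | x + 1 < W ω} := by
    refine (measureReal_mono ?_).trans (measureReal_union_le _ _)
    intro ω hω
    have hω : x - δ < W ω := hω
    rcases lt_or_ge (x + 1) (W ω) with h3 | h3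
    · exact Or.inr h3
    · exact Or.inl ⟨hω.le, h3⟩
  have h2 : P.real {ω | W ω ∈ Set.Icc (x - δ) (x + 1)} ≤ 8 * p x := by
    refine (h.real_W_Icc_le (by linarith)).trans ?_
    refine (h.intervalIntegral_p_le (by linarith)).trans ?_
    have := h.harnack_two hx
    rw [max_eq_left hx0] at this
    rw [show x - δ - δ = x - 2 * δ by ring]
    calc (x + 1 + δ - (x - 2 * δ)) * p (max (x - 2 * δ) 0) ≤ 2 * (4 * p x) :=
          mul_le_mul (by linarith) this (h.p_nonneg _) (by norm_num)
      _ = 8 * p x := by ring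
  have h3 : P.real {ω | x + 1 < W ω} ≤ p x := by
    have h4 := h.mul_real_W_gt_le (x := x + 1) (by linarith)
    have h5 := h.anti hx0 (show x ≤ x + 1 by linarith)
    have h6 : 0 ≤ P.real {ω | x + 1 < W ω} := measureReal_nonneg
    nlinarith
  linarith

end ZeroBiasPair

/-! ### Gaussian bounds for the zero-bias density -/

/-- Monotonicity from a nonnegative derivative that exists off a countable set. -/
lemma le_of_hasDerivAt_nonneg_off_countable {f f' : ℝ → ℝ} {a b : ℝ} {s : Set ℝ} (hab : a ≤ b)
    (hs : s.Countable) (hf : ContinuousOn f (Set.Icc a b))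
    (hd : ∀ x ∈ Set.Ioo a b \ s, HasDerivAt f (f' x) x) (hi : IntervalIntegrable f' volume a b)
    (hn : ∀ x ∈ Set.Icc a b, 0 ≤ f' x) : f a ≤ f b := by
  have h := integral_eq_of_hasDerivAt_off_countable f f' hs (by rwa [Set.uIcc_of_le hab])
    (by rwa [min_eq_left hab, max_eq_right hab]) hi
  have := intervalIntegral.integral_nonneg (μ := volume) hab hn
  linarith

namespace ZeroBiasPair

variable {Ω : Type*} [MeasurableSpace Ω] {P : Measure Ω}
  {W T : Ω → ℝ} {p : ℝ → ℝ} {δ : ℝ}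

lemma setIntegral_T (h : ZeroBiasPair P W T p δ) {s : Set ℝ} (hs : MeasurableSet s) :
    ∫ ω in {ω | T ω ∈ s}, T ω ∂P = ∫ t in s, t * p t := by
  have h1 := setIntegral_map (f := fun t : ℝ => t) hs measurable_id.aestronglyMeasurable
    (h.measT.aemeasurable (μ := P))
  have h2 : ∫ ω in {ω | T ω ∈ s}, T ω ∂P = ∫ t in s, t ∂(P.map T) := h1.symm
  rw [h2, h.law, restrict_withDensity hs,
    integral_withDensity_eq_integral_toReal_smul h.p_meas.ennreal_ofReal (by simp)]
  refine integral_congr_ae (ae_of_all _ fun t => ?_)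
  simp [ENNReal.toReal_ofReal (h.p_nonneg t), mul_comm]

variable [IsProbabilityMeasure P]

lemma integrable_mul_p (h : ZeroBiasPair P W T p δ) : Integrable (fun t => t * p t) := by
  have h1 : Integrable (fun t : ℝ => t) (P.map T) :=
    (integrable_map_measure measurable_id.aestronglyMeasurable h.measT.aemeasurable).2 h.intT
  rw [h.law, integrable_withDensity_iff h.p_meas.ennreal_ofReal (by simp)] at h1
  simpa [ENNReal.toReal_ofReal (h.p_nonneg _)] using h1

/-- Together with `le_upperMoment`: `E[T; T > x]` and `p x ≈ E[W; W > x]` agree up to the relative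
error `25 δ (1 + x)`. In other words the Stein kernel of `T` is close to `1`. -/
lemma upperMoment_le (h : ZeroBiasPair P W T p δ) (hδ : δ ≤ 1 / 3) {x : ℝ} (hx0 : 0 ≤ x)
    (hx : x * δ ≤ 1 / 12) : ∫ ω in {ω | x < T ω}, T ω ∂P ≤ p x * (1 + 25 * δ * (1 + x)) := by
  have hp := h.pos
  have mT : MeasurableSet {ω | x < T ω} := measurableSet_lt measurable_const h.measT
  have mW : MeasurableSet {ω | x - δ < W ω} := measurableSet_lt measurable_const h.measW
  have h1 : ∫ ω in {ω | x < T ω}, T ω ∂P ≤ ∫ ω in {ω | x - δ < W ω}, (W ω + δ) ∂P := by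
    rw [← integral_indicator mT, ← integral_indicator mW]
    refine integral_mono_ae (h.intT.indicator mT)
      ((h.intW.add (integrable_const δ)).indicator mW) ?_
    filter_upwards [h.close] with ω hω
    rw [abs_le] at hω
    by_cases hT : x < T ω
    · rw [Set.indicator_of_mem (show ω ∈ {ω | x < T ω} from hT), Set.indicator_of_mem
        (show ω ∈ {ω | x - δ < W ω} by show x - δ < W ω; linarith)]
      linarith
    · rw [Set.indicator_of_notMem (show ω ∉ {ω | x < T ω} from hT)]
      refine Set.indicator_nonneg ?_ ω
      intro ω' hω'
      have hω' : x - δ < W ω' := hω'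
      linarith
  have h2 : ∫ ω in {ω | x - δ < W ω}, (W ω + δ) ∂P
      = ∫ ω in {ω | x - δ < W ω}, W ω ∂P + δ * P.real {ω | x - δ < W ω} := by
    rw [integral_add h.intW.integrableOn (by simp), setIntegral_const, smul_eq_mul, mul_comm δ]
  have h3 : ∫ ω in {ω | x - δ < W ω}, W ω ∂P ≤ p (max (x - δ) 0) := by
    refine le_trans ?_ (h.low _ (le_max_right _ _))
    have m3 : MeasurableSet {ω | max (x - δ) 0 < W ω} := measurableSet_lt measurable_const h.measW
    rw [← integral_indicator m3, ← integral_indicator mW]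
    refine integral_mono (h.intW.indicator mW) (h.intW.indicator m3) ?_
    intro ω
    by_cases hT : max (x - δ) 0 < W ω
    · rw [Set.indicator_of_mem (show ω ∈ {ω | max (x - δ) 0 < W ω} from hT), Set.indicator_of_mem
        (show ω ∈ {ω | x - δ < W ω} from (le_max_left _ _).trans_lt hT)]
    · rw [Set.indicator_of_notMem (show ω ∉ {ω | max (x - δ) 0 < W ω} from hT)]
      refine Set.indicator_apply_nonpos ?_
      intro hω'
      have hω' : x - δ < W ω := hω'
      by_contra hc
      exact hT (max_lt hω' (not_le.1 hc))
  have h4 : p (max (x - δ) 0) ≤ p x + 12 * δ * x * p x := by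
    rcases hx0.eq_or_lt with rfl | hx1
    · rw [max_eq_right (by linarith)]; simp
    · have h5 := h.max_sub_sub_le hx1
      have h6 := h.harnack_two hx
      rw [max_eq_left hx0] at h6
      have := mul_le_mul_of_nonneg_left h6 (show 0 ≤ 3 * δ * x by positivity)
      linarith
  have h7 := mul_le_mul_of_nonneg_left (h.real_W_gt_sub_le hδ hx0 hx) hp.le
  have h8 : 0 ≤ δ * x * p x := by have := h.p_nonneg x; positivity
  have h9 : 0 ≤ δ * p x := by have := h.p_nonneg x; positivity
  rw [h2] at h1
  nlinarith

lemma le_upperMoment (h : ZeroBiasPair P W T p δ) (hδ : δ ≤ 1 / 3) {x : ℝ} (hx0 : 0 ≤ x)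
    (hx : x * δ ≤ 1 / 12) : p x * (1 - 25 * δ * (1 + x)) ≤ ∫ ω in {ω | x < T ω}, T ω ∂P := by
  have hp := h.pos
  have mT : MeasurableSet {ω | x < T ω} := measurableSet_lt measurable_const h.measT
  have mW : MeasurableSet {ω | x + δ < W ω} := measurableSet_lt measurable_const h.measW
  have h1 : ∫ ω in {ω | x + δ < W ω}, (W ω - δ) ∂P ≤ ∫ ω in {ω | x < T ω}, T ω ∂P := by
    rw [← integral_indicator mT, ← integral_indicator mW]
    refine integral_mono_ae ((h.intW.sub (integrable_const δ)).indicator mW)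
      (h.intT.indicator mT) ?_
    filter_upwards [h.close] with ω hω
    rw [abs_le] at hω
    by_cases hT : x + δ < W ω
    · rw [Set.indicator_of_mem (show ω ∈ {ω | x + δ < W ω} from hT), Set.indicator_of_mem
        (show ω ∈ {ω | x < T ω} by show x < T ω; linarith)]
      linarith
    · rw [Set.indicator_of_notMem (show ω ∉ {ω | x + δ < W ω} from hT)]
      refine Set.indicator_nonneg ?_ ω
      intro ω' hω'
      have hω' : x < T ω' := hω'
      linarith
  have h2 : ∫ ω in {ω | x + δ < W ω}, (W ω - δ) ∂P
      = ∫ ω in {ω | x + δ < W ω}, W ω ∂P - δ * P.real {ω | x + δ < W ω} := by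
    rw [integral_sub h.intW.integrableOn (by simp), setIntegral_const, smul_eq_mul, mul_comm δ]
  have h3 : p (x + 2 * δ) ≤ ∫ ω in {ω | x + δ < W ω}, W ω ∂P :=
    (h.up _ (by linarith)).trans (h.intOn_gt (by linarith) (by linarith))
  have h4 : p x - p (x + 2 * δ) ≤ 8 * δ * (x + 2 * δ) * p x := by
    have h5 := h.increment_le hx0 (show x ≤ x + 2 * δ by linarith)
    have h6 := h.intervalIntegral_p_le (show x - δ ≤ x + 2 * δ + δ by linarith)
    have h7 := h.harnack hx
    rw [max_eq_left hx0] at h7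
    have h8 := mul_le_mul_of_nonneg_left h6 (show 0 ≤ x + 2 * δ by linarith)
    have h9 := mul_le_mul_of_nonneg_left h7 (show 0 ≤ 4 * δ * (x + 2 * δ) by positivity)
    nlinarith
  have h5 : P.real {ω | x + δ < W ω} ≤ 9 * p x := by
    refine le_trans (measureReal_mono ?_) (h.real_W_gt_sub_le hδ hx0 hx)
    intro ω hω
    have hω : x + δ < W ω := hω
    show x - δ < W ω
    linarith
  have h7 := mul_le_mul_of_nonneg_left h5 hp.le
  have h8 : 0 ≤ δ * x * p x := by have := h.p_nonneg x; positivity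
  have h9 : δ * (δ * p x) ≤ 1 / 3 * (δ * p x) :=
    mul_le_mul_of_nonneg_right hδ (by have := h.p_nonneg x; positivity)
  have h10 : 0 ≤ δ * p x := by have := h.p_nonneg x; positivity
  rw [h2] at h1
  nlinarith

lemma upperMoment_eq (h : ZeroBiasPair P W T p δ) {x : ℝ} (hx0 : 0 ≤ x) :
    ∫ ω in {ω | x < T ω}, T ω ∂P
      = ∫ ω in {ω | 0 < T ω}, T ω ∂P - ∫ t in (0 : ℝ)..x, t * p (max t 0) := by
  have h1 : ∀ y, ∫ ω in {ω | y < T ω}, T ω ∂P = ∫ t in Set.Ioi y, t * p t :=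
    fun y => h.setIntegral_T measurableSet_Ioi
  have h2 := intervalIntegral.integral_Ioi_sub_Ioi' (a := 0) (b := x)
    h.integrable_mul_p.integrableOn h.integrable_mul_p.integrableOn
  have h3 : ∫ t in (0 : ℝ)..x, t * p (max t 0) = ∫ t in (0 : ℝ)..x, t * p t := by
    refine intervalIntegral.integral_congr ?_
    intro t ht
    rw [Set.uIcc_of_le hx0] at ht
    simp only [max_eq_left ht.1]
  rw [h1, h1, h3, ← h2]
  ring

lemma intervalIntegrable_max (h : ZeroBiasPair P W T p δ) (a b : ℝ) :
    IntervalIntegrable (fun t => t * p (max t 0)) volume a b :=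
  h.anti_max.intervalIntegrable.continuousOn_mul continuousOn_id

/-- The function `A x = E[T; T > x]` has derivative `-x p x` wherever `p` is continuous; this is
the derivative of `exp (F x) * A x`. -/
lemma hasDerivAt_exp_mul_upperMoment (h : ZeroBiasPair P W T p δ) (F : ℝ → ℝ) {F' a x : ℝ}
    (hF : HasDerivAt F F' x) (hx : ContinuousAt (fun x => p (max x 0)) x) :
    HasDerivAt (fun x => Real.exp (F x) * (a - ∫ t in (0 : ℝ)..x, t * p (max t 0)))
      (Real.exp (F x) * (F' * (a - ∫ t in (0 : ℝ)..x, t * p (max t 0)) - x * p (max x 0))) x := by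
  have hm : Measurable (fun t => t * p (max t 0)) :=
    measurable_id.mul (h.p_meas.comp (measurable_id.max measurable_const))
  have h1 := intervalIntegral.integral_hasDerivAt_right (h.intervalIntegrable_max 0 x)
    hm.stronglyMeasurable.stronglyMeasurableAtFilter (continuousAt_id.mul hx)
  refine HasDerivAt.congr_deriv (hF.exp.mul (h1.const_sub a)) ?_
  ring

lemma continuous_exp_mul_upperMoment (h : ZeroBiasPair P W T p δ) {F : ℝ → ℝ} (a : ℝ)
    (hF : Continuous F) :
    Continuous (fun x => Real.exp (F x) * (a - ∫ t in (0 : ℝ)..x, t * p (max t 0))) := by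
  have := intervalIntegral.continuous_primitive h.intervalIntegrable_max 0
  fun_prop

lemma intervalIntegrable_exp_mul (h : ZeroBiasPair P W T p δ) {F F' : ℝ → ℝ} (a u v : ℝ)
    (hF : Continuous F) (hF' : Continuous F') :
    IntervalIntegrable (fun x => Real.exp (F x) *
      (F' x * (a - ∫ t in (0 : ℝ)..x, t * p (max t 0)) - x * p (max x 0))) volume u v := by
  have h1 := intervalIntegral.continuous_primitive h.intervalIntegrable_max 0
  refine IntervalIntegrable.continuousOn_mul (IntervalIntegrable.sub ?_
    (h.intervalIntegrable_max u v)) (by fun_prop)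
  exact Continuous.intervalIntegrable (by fun_prop) _ _

/-- Integrating `A' = -x p ≥ -x (1 + 50 δ (1 + x)) A`, where `A x = E[T; T > x]`. The exponent is
the primitive of `x (1 + 50 δ (1 + x))`. -/
lemma upperMoment_ge_exp (h : ZeroBiasPair P W T p δ) (hδ : δ ≤ 1 / 1000) {x : ℝ} (hx0 : 0 ≤ x)
    (hx : x * δ ≤ 1 / 1000) :
    ∫ ω in {ω | 0 < T ω}, T ω ∂P ≤ Real.exp (x ^ 2 / 2 + 25 * δ * x ^ 2 + 50 / 3 * δ * x ^ 3) *
      ∫ ω in {ω | x < T ω}, T ω ∂P := by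
  have hp := h.pos
  set a := ∫ ω in {ω | 0 < T ω}, T ω ∂P with ha
  set F : ℝ → ℝ := fun x => x ^ 2 / 2 + 25 * δ * x ^ 2 + 50 / 3 * δ * x ^ 3 with hF
  have hd : ∀ y, HasDerivAt F (y * (1 + 50 * δ * (1 + y))) y := by
    intro y
    have h1 := (((hasDerivAt_pow 2 y).div_const 2).add
      ((hasDerivAt_pow 2 y).const_mul (25 * δ))).add ((hasDerivAt_pow 3 y).const_mul (50 / 3 * δ))
    refine HasDerivAt.congr_deriv (f := F) h1 ?_
    norm_num
    ring
  have key := le_of_hasDerivAt_nonneg_off_countable hx0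
    h.anti_max.countable_not_continuousAt
    (h.continuous_exp_mul_upperMoment (F := F) a (by fun_prop)).continuousOn
    (fun y hy => h.hasDerivAt_exp_mul_upperMoment F (a := a) (hd y) (by
      by_contra hc; exact hy.2 hc))
    (h.intervalIntegrable_exp_mul a 0 x (by fun_prop) (by fun_prop)) ?_
  · rw [← h.upperMoment_eq hx0] at key
    simpa [hF] using key
  · intro y hy
    have hyδ : y * δ ≤ 1 / 1000 := (mul_le_mul_of_nonneg_right hy.2 hp.le).trans hx
    rw [← h.upperMoment_eq hy.1, max_eq_left hy.1]
    have h1 := h.le_upperMoment (by linarith) hy.1 (by linarith)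
    set A := ∫ ω in {ω | y < T ω}, T ω ∂P
    set η := 25 * δ * (1 + y) with hη
    have h2 : 0 ≤ η := by have := hy.1; positivity
    have h3 : η ≤ 1 / 2 := by rw [hη]; nlinarith
    have h4 := h.p_nonneg y
    have h5 : p y ≤ (1 + 2 * η) * A := by
      have h6 : (1 + 2 * η) * (p y * (1 - η)) ≤ (1 + 2 * η) * A :=
        mul_le_mul_of_nonneg_left h1 (by linarith)
      have h7 : 0 ≤ p y * (η * (1 - 2 * η)) := by
        have : 0 ≤ 1 - 2 * η := by linarith
        positivity
      nlinarith
    have h6 : 0 ≤ y * ((1 + 2 * η) * A - p y) := mul_nonneg hy.1 (by linarith)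
    refine mul_nonneg (Real.exp_pos _).le ?_
    have : y * (1 + 50 * δ * (1 + y)) * A - y * p y = y * ((1 + 2 * η) * A - p y) := by
      rw [hη]; ring
    rw [this]; exact h6

/-- Integrating `A' = -x p ≤ -x (1 - 50 δ (1 + x)) A`, where `A x = E[T; T > x]`. -/
lemma upperMoment_le_exp (h : ZeroBiasPair P W T p δ) (hδ : δ ≤ 1 / 1000) {x : ℝ} (hx0 : 0 ≤ x)
    (hx : x * δ ≤ 1 / 1000) :
    Real.exp (x ^ 2 / 2 - 25 * δ * x ^ 2 - 50 / 3 * δ * x ^ 3) * ∫ ω in {ω | x < T ω}, T ω ∂P ≤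
      ∫ ω in {ω | 0 < T ω}, T ω ∂P := by
  have hp := h.pos
  set a := ∫ ω in {ω | 0 < T ω}, T ω ∂P with ha
  set F : ℝ → ℝ := fun x => x ^ 2 / 2 - 25 * δ * x ^ 2 - 50 / 3 * δ * x ^ 3 with hF
  have hd : ∀ y, HasDerivAt F (y * (1 - 50 * δ * (1 + y))) y := by
    intro y
    have h1 := (((hasDerivAt_pow 2 y).div_const 2).sub
      ((hasDerivAt_pow 2 y).const_mul (25 * δ))).sub ((hasDerivAt_pow 3 y).const_mul (50 / 3 * δ))
    refine HasDerivAt.congr_deriv (f := F) h1 ?_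
    norm_num
    ring
  have key := le_of_hasDerivAt_nonneg_off_countable hx0
    h.anti_max.countable_not_continuousAt
    (h.continuous_exp_mul_upperMoment (F := F) a (by fun_prop)).neg.continuousOn
    (fun y hy => (h.hasDerivAt_exp_mul_upperMoment F (a := a) (hd y) (by
      by_contra hc; exact hy.2 hc)).neg)
    (h.intervalIntegrable_exp_mul a 0 x (by fun_prop) (by fun_prop)).neg ?_
  · simp only [Pi.neg_apply] at key
    rw [← h.upperMoment_eq hx0] at key
    simp [hF] at key
    linarith
  · intro y hy
    have hyδ : y * δ ≤ 1 / 1000 := (mul_le_mul_of_nonneg_right hy.2 hp.le).trans hx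
    rw [← h.upperMoment_eq hy.1, max_eq_left hy.1]
    have h1 := h.upperMoment_le (by linarith) hy.1 (by linarith)
    set A := ∫ ω in {ω | y < T ω}, T ω ∂P
    set η := 25 * δ * (1 + y) with hη
    have h2 : 0 ≤ η := by have := hy.1; positivity
    have h3 : η ≤ 1 / 2 := by rw [hη]; nlinarith
    have h4 := h.p_nonneg y
    have h5 : (1 - 2 * η) * A ≤ p y := by
      have h6 : (1 - 2 * η) * A ≤ (1 - 2 * η) * (p y * (1 + η)) :=
        mul_le_mul_of_nonneg_left h1 (by linarith)
      have h7 : 0 ≤ p y * (η * (1 + 2 * η)) := by positivity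
      nlinarith
    have h6 : 0 ≤ y * (p y - (1 - 2 * η) * A) := mul_nonneg hy.1 (by linarith)
    have : -(Real.exp (F y) * (y * (1 - 50 * δ * (1 + y)) * A - y * p y))
        = Real.exp (F y) * (y * (p y - (1 - 2 * η) * A)) := by
      rw [hη]; ring
    rw [this]
    exact mul_nonneg (Real.exp_pos _).le h6

lemma p_zero_pos (h : ZeroBiasPair P W T p δ) : 0 < p 0 := by
  by_contra hc
  have h0 : ∀ x, p x = 0 := fun x => le_antisymm ((h.p_le x).trans (not_lt.1 hc)) (h.p_nonneg x)
  have := h.integral_p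
  simp [h0] at this

/-- Gaussian upper bound for the density `p` with its exact leading exponent, valid up to `x` of
order `1 / δ`. -/
lemma p_le_exp (h : ZeroBiasPair P W T p δ) (hδ : δ ≤ 1 / 1000) {x : ℝ} (hx0 : 0 ≤ x)
    (hx : x * δ ≤ 1 / 1000) :
    p x ≤ p 0 * Real.exp (-x ^ 2 / 2 + 150 * δ * (1 + x ^ 3)) := by
  have hp := h.pos
  have h0 := h.p_zero_pos
  have h1 := h.upperMoment_le_exp hδ hx0 hx
  have h2 := h.le_upperMoment (by linarith) hx0 (by linarith)
  have h3 := h.upperMoment_le (x := 0) (by linarith) le_rfl (by linarith)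
  set A := ∫ ω in {ω | x < T ω}, T ω ∂P
  set A0 := ∫ ω in {ω | 0 < T ω}, T ω ∂P
  set η := 25 * δ * (1 + x) with hη
  have e2 : 0 ≤ η := by positivity
  have e3 : η ≤ 1 / 2 := by rw [hη]; nlinarith
  have e4 := h.p_nonneg x
  have h5 : p x ≤ (1 + 2 * η) * A := by
    have h6 : (1 + 2 * η) * (p x * (1 - η)) ≤ (1 + 2 * η) * A :=
      mul_le_mul_of_nonneg_left h2 (by linarith)
    have h7 : 0 ≤ p x * (η * (1 - 2 * η)) := by
      have : 0 ≤ 1 - 2 * η := by linarith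
      positivity
    nlinarith
  have h6 : p x ≤ Real.exp (2 * η) * A := by
    have hA : 0 ≤ A := by
      have : 0 < 1 + 2 * η := by linarith
      by_contra hc
      have := mul_neg_of_pos_of_neg this (not_le.1 hc)
      linarith
    refine h5.trans (mul_le_mul_of_nonneg_right ?_ hA)
    linarith [Real.add_one_le_exp (2 * η)]
  have h7 : A0 ≤ p 0 * Real.exp (25 * δ) := by
    refine h3.trans (mul_le_mul_of_nonneg_left ?_ h0.le)
    linarith [Real.add_one_le_exp (25 * δ)]
  set E := x ^ 2 / 2 - 25 * δ * x ^ 2 - 50 / 3 * δ * x ^ 3 with hE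
  have h8 : A ≤ Real.exp (-E) * A0 := by
    have := mul_le_mul_of_nonneg_left h1 (Real.exp_pos (-E)).le
    rwa [← mul_assoc, ← Real.exp_add, neg_add_cancel, Real.exp_zero, one_mul] at this
  calc p x ≤ Real.exp (2 * η) * (Real.exp (-E) * (p 0 * Real.exp (25 * δ))) :=
        h6.trans (mul_le_mul_of_nonneg_left (h8.trans
          (mul_le_mul_of_nonneg_left h7 (Real.exp_pos _).le)) (Real.exp_pos _).le)
    _ = p 0 * Real.exp (2 * η + -E + 25 * δ) := by rw [Real.exp_add, Real.exp_add]; ring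
    _ ≤ _ := by
      refine mul_le_mul_of_nonneg_left (Real.exp_le_exp.2 ?_) h0.le
      have q1 : x ≤ 1 + x ^ 3 := by nlinarith [mul_nonneg hx0 (sq_nonneg (x - 1))]
      have q2 : x ^ 2 ≤ 1 + x ^ 3 := by
        nlinarith [mul_nonneg (show 0 ≤ x + 1 by linarith) (sq_nonneg (x - 1))]
      have q3 : 0 ≤ x ^ 3 := by positivity
      have : 75 + 50 * x + 25 * x ^ 2 + 50 / 3 * x ^ 3 ≤ 150 * (1 + x ^ 3) := by linarith
      have := mul_le_mul_of_nonneg_left this hp.le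
      rw [hE, hη]
      nlinarith

lemma exp_le_p (h : ZeroBiasPair P W T p δ) (hδ : δ ≤ 1 / 1000) {x : ℝ} (hx0 : 0 ≤ x)
    (hx : x * δ ≤ 1 / 1000) :
    p 0 * Real.exp (-x ^ 2 / 2 - 150 * δ * (1 + x ^ 3)) ≤ p x := by
  have hp := h.pos
  have h0 := h.p_zero_pos
  have h1 := h.upperMoment_ge_exp hδ hx0 hx
  have h2 := h.upperMoment_le (by linarith) hx0 (by linarith)
  have h3 := h.le_upperMoment (x := 0) (by linarith) le_rfl (by linarith)
  set A := ∫ ω in {ω | x < T ω}, T ω ∂P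
  set A0 := ∫ ω in {ω | 0 < T ω}, T ω ∂P
  set η := 25 * δ * (1 + x) with hη
  have e4 := h.p_nonneg x
  have h6 : A ≤ Real.exp η * p x := by
    rw [mul_comm]
    refine h2.trans (mul_le_mul_of_nonneg_left ?_ e4)
    linarith [Real.add_one_le_exp η]
  have h7 : p 0 * Real.exp (-(50 * δ)) ≤ A0 := by
    refine le_trans (mul_le_mul_of_nonneg_left ?_ h0.le) h3
    have := Real.one_sub_inv_le_log_of_pos (show 0 < 1 - 25 * δ by linarith)
    have h8 : Real.log (1 - 25 * δ) ≥ -(50 * δ) := by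
      refine le_trans ?_ this
      have : (1 - 25 * δ)⁻¹ ≤ 1 + 50 * δ := by
        rw [inv_le_iff_one_le_mul₀ (by linarith)]
        nlinarith
      linarith
    have h9 := Real.exp_le_exp.2 h8
    rw [Real.exp_log (by linarith)] at h9
    linarith
  set E := x ^ 2 / 2 + 25 * δ * x ^ 2 + 50 / 3 * δ * x ^ 3 with hE
  have h10 : p 0 * Real.exp (-(50 * δ)) ≤ Real.exp E * (Real.exp η * p x) :=
    h7.trans (h1.trans (mul_le_mul_of_nonneg_left h6 (Real.exp_pos _).le))
  have h11 : p 0 * Real.exp (-(50 * δ) - E - η) ≤ p x := by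
    have gen : ∀ a b : ℝ, Real.exp (-a - b) * (Real.exp a * (Real.exp b * p x)) = p x := by
      intro a b
      rw [← mul_assoc, ← mul_assoc, ← Real.exp_add, ← Real.exp_add,
        show -a - b + a + b = 0 by ring, Real.exp_zero, one_mul]
    have := mul_le_mul_of_nonneg_left h10 (Real.exp_pos (-E - η)).le
    calc p 0 * Real.exp (-(50 * δ) - E - η)
        = Real.exp (-E - η) * (p 0 * Real.exp (-(50 * δ))) := by
          rw [show -(50 * δ) - E - η = (-E - η) + -(50 * δ) by ring, Real.exp_add]; ring
      _ ≤ Real.exp (-E - η) * (Real.exp E * (Real.exp η * p x)) := this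
      _ = p x := gen E η
  refine le_trans (mul_le_mul_of_nonneg_left (Real.exp_le_exp.2 ?_) h0.le) h11
  have q1 : x ≤ 1 + x ^ 3 := by nlinarith [mul_nonneg hx0 (sq_nonneg (x - 1))]
  have q2 : x ^ 2 ≤ 1 + x ^ 3 := by
    nlinarith [mul_nonneg (show 0 ≤ x + 1 by linarith) (sq_nonneg (x - 1))]
  have q3 : 0 ≤ x ^ 3 := by positivity
  have : 75 + 50 * x + 25 * x ^ 2 + 50 / 3 * x ^ 3 ≤ 150 * (1 + x ^ 3) := by linarith
  have := mul_le_mul_of_nonneg_left this hp.le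
  rw [hE, hη]
  nlinarith

end ZeroBiasPair

/-! ### Normalisation and a Berry–Esseen bound -/

/-- The upper tail `P(N > y)` of a standard normal variable `N`. -/
noncomputable def gaussTail (y : ℝ) : ℝ := (gaussianReal 0 1).real (Set.Ioi y)

lemma gaussTail_eq_integral (y : ℝ) :
    gaussTail y = ∫ x in Set.Ioi y, gaussianPDFReal 0 1 x := by
  rw [gaussTail, Measure.real, gaussianReal_apply_eq_integral 0 one_ne_zero,
    ENNReal.toReal_ofReal]
  exact integral_nonneg fun x => gaussianPDFReal_nonneg 0 1 x

lemma gaussianPDFReal_std (x : ℝ) :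
    gaussianPDFReal 0 1 x = (√(2 * Real.pi))⁻¹ * Real.exp (-x ^ 2 / 2) := by
  simp [gaussianPDFReal]

lemma gaussTail_sub (u v : ℝ) :
    gaussTail u - gaussTail v = ∫ x in u..v, gaussianPDFReal 0 1 x := by
  rw [gaussTail_eq_integral, gaussTail_eq_integral]
  exact intervalIntegral.integral_Ioi_sub_Ioi' (integrable_gaussianPDFReal 0 1).integrableOn
    (integrable_gaussianPDFReal 0 1).integrableOn

lemma gaussTail_antitone : Antitone gaussTail := fun _ _ h =>
  measureReal_mono (Set.Ioi_subset_Ioi h)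

lemma gaussTail_nonneg (y : ℝ) : 0 ≤ gaussTail y := measureReal_nonneg

lemma gaussTail_le_one (y : ℝ) : gaussTail y ≤ 1 := measureReal_le_one

lemma integrable_one_add_cube_mul_exp :
    Integrable (fun x : ℝ => (1 + |x| ^ 3) * Real.exp (-x ^ 2 / 4)) := by
  have h1 := (integrable_rpow_mul_exp_neg_mul_sq (b := 1 / 4) (by norm_num) (s := 3)
    (by norm_num)).abs
  have h2 := integrable_exp_neg_mul_sq (b := 1 / 4) (by norm_num)
  refine (h2.add h1).congr (ae_of_all _ fun x => ?_)
  simp only [Pi.add_apply, abs_mul, Real.abs_exp]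
  have : x ^ (3 : ℝ) = x ^ 3 := by exact_mod_cast Real.rpow_natCast x 3
  rw [this, abs_pow, show -x ^ 2 / 4 = -(1 / 4) * x ^ 2 by ring]
  ring

lemma sqrt_two_pi_pos : 0 < √(2 * Real.pi) := Real.sqrt_pos.2 (by positivity)

lemma one_le_sqrt_two_pi : 1 ≤ √(2 * Real.pi) := by
  rw [Real.one_le_sqrt]
  linarith [Real.pi_gt_three]

lemma exp_neg_sq_eq (x : ℝ) :
    Real.exp (-x ^ 2 / 2) = √(2 * Real.pi) * gaussianPDFReal 0 1 x := by
  rw [gaussianPDFReal_std, ← mul_assoc, mul_inv_cancel₀ sqrt_two_pi_pos.ne', one_mul]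

/-- The absolute constant `∫ (1 + |x|³) exp (-x² / 4) dx`, which turns the pointwise error of the
Gaussian approximation to `p` into an `L¹` error. -/
noncomputable def cubeMoment : ℝ := ∫ x : ℝ, (1 + |x| ^ 3) * Real.exp (-x ^ 2 / 4)

lemma cubeMoment_nonneg : 0 ≤ cubeMoment :=
  integral_nonneg fun x => by positivity

namespace ZeroBiasPair

variable {Ω : Type*} [MeasurableSpace Ω] {P : Measure Ω} [IsProbabilityMeasure P]
  {W T : Ω → ℝ} {p : ℝ → ℝ} {δ : ℝ}

lemma p_le_exp_abs (h : ZeroBiasPair P W T p δ) (h' : ZeroBiasPair P (-W) (-T) (fun x => p (-x)) δ)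
    (hδ : δ ≤ 1 / 1000) {x : ℝ} (hx : |x| * δ ≤ 1 / 1000) :
    p x ≤ p 0 * Real.exp (-x ^ 2 / 2 + 150 * δ * (1 + |x| ^ 3)) := by
  rcases le_total 0 x with h0 | h0
  · rw [abs_of_nonneg h0] at *
    exact h.p_le_exp hδ h0 hx
  · rw [abs_of_nonpos h0] at *
    have := h'.p_le_exp hδ (neg_nonneg.2 h0) hx
    simpa using this

lemma exp_le_p_abs (h : ZeroBiasPair P W T p δ) (h' : ZeroBiasPair P (-W) (-T) (fun x => p (-x)) δ)
    (hδ : δ ≤ 1 / 1000) {x : ℝ} (hx : |x| * δ ≤ 1 / 1000) :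
    p 0 * Real.exp (-x ^ 2 / 2 - 150 * δ * (1 + |x| ^ 3)) ≤ p x := by
  rcases le_total 0 x with h0 | h0
  · rw [abs_of_nonneg h0] at *
    exact h.exp_le_p hδ h0 hx
  · rw [abs_of_nonpos h0] at *
    have := h'.exp_le_p hδ (neg_nonneg.2 h0) hx
    simpa using this

lemma real_T_gt_le_p (h : ZeroBiasPair P W T p δ) (hδ : δ ≤ 1 / 3) {x : ℝ} (hx0 : 0 ≤ x)
    (hx : x * δ ≤ 1 / 12) : P.real {ω | x < T ω} ≤ 9 * p x :=
  (h.real_T_gt_le x).trans (h.real_W_gt_sub_le hδ hx0 hx)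

lemma abs_sub_le_of_abs_le (h : ZeroBiasPair P W T p δ)
    (h' : ZeroBiasPair P (-W) (-T) (fun x => p (-x)) δ)
    (hδ : δ ≤ 1 / 1000) {x : ℝ} (hx : |x| * δ ≤ 1 / 1000) :
    |p x - p 0 * Real.exp (-x ^ 2 / 2)|
      ≤ 300 * δ * p 0 * ((1 + |x| ^ 3) * Real.exp (-x ^ 2 / 4)) := by
  have hp := h.pos
  have h0 := h.p_zero_pos
  have h1 := h.p_le_exp_abs h' hδ hx
  have h2 := h.exp_le_p_abs h' hδ hx
  set E := 150 * δ * (1 + |x| ^ 3) with hE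
  have hE0 : 0 ≤ E := by positivity
  have hE1 : E ≤ 3 / 20 + 3 / 20 * x ^ 2 := by
    have : δ * |x| ^ 3 ≤ 1 / 1000 * x ^ 2 := by
      rw [← sq_abs x]
      have := mul_le_mul_of_nonneg_right hx (sq_nonneg |x|)
      nlinarith
    rw [hE]
    nlinarith
  have hE2 : Real.exp (-x ^ 2 / 2) * Real.exp E ≤ 2 * Real.exp (-x ^ 2 / 4) := by
    have h2 : Real.exp (1 / 2) ≤ 2 := by
      have := Real.exp_bound_div_one_sub_of_interval (x := 1 / 2) (by norm_num) (by norm_num)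
      norm_num at this ⊢
      linarith
    rw [← Real.exp_add]
    calc Real.exp (-x ^ 2 / 2 + E) ≤ Real.exp (1 / 2 + -x ^ 2 / 4) := by
          refine Real.exp_le_exp.2 ?_
          nlinarith [sq_nonneg x]
      _ = Real.exp (1 / 2) * Real.exp (-x ^ 2 / 4) := Real.exp_add _ _
      _ ≤ _ := mul_le_mul_of_nonneg_right h2 (Real.exp_pos _).le
  have hR : p 0 * (E * (Real.exp (-x ^ 2 / 2) * Real.exp E))
      ≤ 300 * δ * p 0 * ((1 + |x| ^ 3) * Real.exp (-x ^ 2 / 4)) := by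
    have := mul_le_mul_of_nonneg_left (mul_le_mul_of_nonneg_left hE2 hE0) h0.le
    refine this.trans (le_of_eq ?_)
    rw [hE]; ring
  have hexp : Real.exp E - 1 ≤ E * Real.exp E := by
    have := Real.add_one_le_exp (-E)
    have h5 := mul_le_mul_of_nonneg_right this (Real.exp_pos E).le
    rw [← Real.exp_add, neg_add_cancel, Real.exp_zero] at h5
    linarith
  have he1 : 1 ≤ Real.exp E := Real.one_le_exp hE0
  have hexp' : 1 - Real.exp (-E) ≤ E * Real.exp E := by
    have := Real.add_one_le_exp (-E)
    nlinarith
  refine le_trans ?_ hR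
  have hq : 0 < p 0 * Real.exp (-x ^ 2 / 2) := by positivity
  rw [abs_le]
  constructor
  · rw [Real.exp_sub, div_eq_mul_inv, ← Real.exp_neg] at h2
    nlinarith
  · rw [Real.exp_add] at h1
    nlinarith

/-- Beyond `|x| = 1 / (1000 δ)` the Gaussian density is smaller than the error allowed inside that
range. -/
lemma exp_neg_sq_le_of_lt_abs (hp : 0 < δ) (hδ : δ ≤ 1 / 10000) {x : ℝ}
    (hx : 1 / 1000 < |x| * δ) :
    Real.exp (-x ^ 2 / 2) ≤ 300 * δ * ((1 + |x| ^ 3) * Real.exp (-x ^ 2 / 4)) := by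
  have h1 : 1 ≤ 300 * δ * (1 + |x| ^ 3) := by
    have hx1 : 10 ≤ |x| := by
      by_contra hc
      have := mul_lt_mul_of_pos_right (not_le.1 hc) hp
      nlinarith
    have : 1 / 1000 * 100 ≤ |x| * δ * |x| ^ 2 :=
      mul_le_mul hx.le (by nlinarith) (by norm_num) (by positivity)
    nlinarith
  have h2 : Real.exp (-x ^ 2 / 2) ≤ Real.exp (-x ^ 2 / 4) :=
    Real.exp_le_exp.2 (by nlinarith [sq_nonneg x])
  calc Real.exp (-x ^ 2 / 2) ≤ 1 * Real.exp (-x ^ 2 / 4) := by linarith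
    _ ≤ 300 * δ * (1 + |x| ^ 3) * Real.exp (-x ^ 2 / 4) :=
      mul_le_mul_of_nonneg_right h1 (Real.exp_pos _).le
    _ = _ := by ring

lemma far_tail_le (h : ZeroBiasPair P W T p δ) (hδ : δ ≤ 1 / 10000) :
    P.real {ω | 1 / (1000 * δ) < T ω} ≤ 7200 * δ * p 0 := by
  have hp := h.pos
  have h0 := h.p_zero_pos
  set b := 1 / (1000 * δ) with hb
  have hb0 : 0 < b := by positivity
  have hbδ : b * δ = 1 / 1000 := by rw [hb]; field_simp
  have h1 := h.real_T_gt_le_p (by linarith) hb0.le (by linarith)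
  have h2 := h.p_le_exp (by linarith) hb0.le hbδ.le
  have hb1 : 10 ≤ b := by
    by_contra hc
    have := mul_lt_mul_of_pos_right (not_le.1 hc) hp
    nlinarith
  have h3 : Real.exp (-b ^ 2 / 2 + 150 * δ * (1 + b ^ 3)) ≤ 800 * δ := by
    have h4 : -b ^ 2 / 2 + 150 * δ * (1 + b ^ 3) ≤ -(b ^ 2 / 4) := by
      have : δ * b ^ 3 = 1 / 1000 * b ^ 2 := by rw [← hbδ]; ring
      nlinarith
    have h5 : Real.exp (-(b ^ 2 / 4)) ≤ 4 / b ^ 2 := by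
      rw [Real.exp_neg, inv_le_comm₀ (Real.exp_pos _) (by positivity), inv_div]
      linarith [Real.add_one_le_exp (b ^ 2 / 4)]
    have h6 : 4 / b ^ 2 ≤ 800 * δ := by
      rw [div_le_iff₀ (by positivity)]
      have : δ * b ^ 2 = 1 / 1000 * b := by rw [← hbδ]; ring
      nlinarith
    exact (Real.exp_le_exp.2 h4).trans (h5.trans h6)
  have h4 := mul_le_mul_of_nonneg_left h3 h0.le
  linarith

lemma integrable_sub (h : ZeroBiasPair P W T p δ) :
    Integrable (fun x => p x - p 0 * Real.exp (-x ^ 2 / 2)) := by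
  refine h.integrable_p.sub (Integrable.const_mul ?_ _)
  have := integrable_exp_neg_mul_sq (b := 1 / 2) (by norm_num)
  refine this.congr (ae_of_all _ fun x => ?_)
  simp only
  congr 1
  ring

/-- The density of `T` is within `O(δ)` in `L¹` of the multiple of the Gaussian density that has
the same value at `0`. -/
lemma integral_abs_sub_le (h : ZeroBiasPair P W T p δ)
    (h' : ZeroBiasPair P (-W) (-T) (fun x => p (-x)) δ) (hδ : δ ≤ 1 / 10000) :
    ∫ x, |p x - p 0 * Real.exp (-x ^ 2 / 2)| ≤ (300 * cubeMoment + 14400) * δ * p 0 := by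
  have hp := h.pos
  have h0 := h.p_zero_pos
  set b := 1 / (1000 * δ) with hb
  have hbp : 0 < b := by positivity
  have hbδ : b * δ = 1 / 1000 := by rw [hb]; field_simp
  have hT1 : ∫ x in Set.Ioi b, p x ≤ 7200 * δ * p 0 := by
    rw [← h.real_T_gt]; exact h.far_tail_le hδ
  have hT2 : ∫ x in Set.Iio (-b), p x ≤ 7200 * δ * p 0 := by
    have := h'.far_tail_le hδ
    rw [h'.real_T_gt, integral_comp_neg_Ioi (f := p), neg_zero] at this
    rwa [← integral_Iic_eq_integral_Iio]
  have hpt : ∀ x, |p x - p 0 * Real.exp (-x ^ 2 / 2)| ≤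
      300 * δ * p 0 * ((1 + |x| ^ 3) * Real.exp (-x ^ 2 / 4)) +
        ((Set.Ioi b).indicator p x + (Set.Iio (-b)).indicator p x) := by
    intro x
    have n1 : 0 ≤ (Set.Ioi b).indicator p x := Set.indicator_nonneg (fun y _ => h.p_nonneg y) x
    have n2 : 0 ≤ (Set.Iio (-b)).indicator p x :=
      Set.indicator_nonneg (fun y _ => h.p_nonneg y) x
    rcases le_or_gt |x| b with hx | hx
    · have := h.abs_sub_le_of_abs_le h' (by linarith) (x := x)
        ((mul_le_mul_of_nonneg_right hx hp.le).trans hbδ.le)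
      linarith
    · have h3 : p x ≤ (Set.Ioi b).indicator p x + (Set.Iio (-b)).indicator p x := by
        rcases lt_abs.1 hx with hx | hx
        · rw [Set.indicator_of_mem (show x ∈ Set.Ioi b from hx)]; linarith
        · rw [Set.indicator_of_mem (show x ∈ Set.Iio (-b) by
            show x < -b; linarith)]
          linarith
      have h4 := exp_neg_sq_le_of_lt_abs hp hδ (x := x)
        (by rw [← hbδ]; exact mul_lt_mul_of_pos_right hx hp)
      have h5 := mul_le_mul_of_nonneg_left h4 h0.le
      have h6 : 0 ≤ p 0 * Real.exp (-x ^ 2 / 2) := by positivity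
      have h7 := h.p_nonneg x
      rw [abs_le]
      constructor <;> nlinarith
  have i1 : Integrable (fun x : ℝ => 300 * δ * p 0 * ((1 + |x| ^ 3) * Real.exp (-x ^ 2 / 4))) :=
    integrable_one_add_cube_mul_exp.const_mul _
  have i2 : Integrable ((Set.Ioi b).indicator p) := h.integrable_p.indicator measurableSet_Ioi
  have i3 : Integrable ((Set.Iio (-b)).indicator p) := h.integrable_p.indicator measurableSet_Iio
  have := integral_mono h.integrable_sub.abs (i1.add (i2.add i3)) hpt
  refine this.trans ?_
  have e : ∫ x, ((fun x : ℝ => 300 * δ * p 0 * ((1 + |x| ^ 3) * Real.exp (-x ^ 2 / 4))) +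
      ((Set.Ioi b).indicator p + (Set.Iio (-b)).indicator p) : ℝ → ℝ) x
      = 300 * δ * p 0 * cubeMoment + ((∫ x in Set.Ioi b, p x) + ∫ x in Set.Iio (-b), p x) := by
    rw [integral_add' i1 (i2.add i3), integral_add' i2 i3, integral_const_mul,
      integral_indicator measurableSet_Ioi, integral_indicator measurableSet_Iio]
    rfl
  rw [e]
  linarith

lemma abs_setIntegral_sub_le (h : ZeroBiasPair P W T p δ)
    (h' : ZeroBiasPair P (-W) (-T) (fun x => p (-x)) δ) (hδ : δ ≤ 1 / 10000) (s : Set ℝ) :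
    |(∫ x in s, p x) - p 0 * √(2 * Real.pi) * ∫ x in s, gaussianPDFReal 0 1 x|
      ≤ (300 * cubeMoment + 14400) * δ * p 0 := by
  have e : (∫ x in s, p x) - p 0 * √(2 * Real.pi) * ∫ x in s, gaussianPDFReal 0 1 x
      = ∫ x in s, (p x - p 0 * Real.exp (-x ^ 2 / 2)) := by
    rw [integral_sub h.integrable_p.integrableOn ?_]
    · congr 1
      rw [← integral_const_mul]
      refine integral_congr_ae (ae_of_all _ fun x => ?_)
      simp only [exp_neg_sq_eq]; ring
    · refine Integrable.integrableOn ?_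
      simp only [exp_neg_sq_eq]
      exact ((integrable_gaussianPDFReal 0 1).const_mul _).const_mul _
  rw [e]
  refine (abs_integral_le_integral_abs).trans ?_
  refine (setIntegral_le_integral h.integrable_sub.abs (ae_of_all _ fun x => abs_nonneg _)).trans ?_
  exact h.integral_abs_sub_le h' hδ

/-- Berry–Esseen bound for `T`. Since `p` has total mass `1`, the `L¹` bound on the whole line pins
the unknown value `p 0` to `1 / √(2π)` up to a relative error `O(δ)`. -/
lemma berryEsseen (h : ZeroBiasPair P W T p δ)
    (h' : ZeroBiasPair P (-W) (-T) (fun x => p (-x)) δ) (hδ : δ ≤ 1 / 10000)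
    (hδ' : (300 * cubeMoment + 14400) * δ ≤ 1 / 2) :
    |p 0 * √(2 * Real.pi) - 1| ≤ 4 * (300 * cubeMoment + 14400) * δ ∧
    ∀ y, |P.real {ω | y < T ω} - gaussTail y| ≤ 4 * (300 * cubeMoment + 14400) * δ := by
  have hp := h.pos
  have h0 := h.p_zero_pos
  have h1 := h.abs_setIntegral_sub_le h' hδ Set.univ
  have hm := cubeMoment_nonneg
  set C := 300 * cubeMoment + 14400 with hC
  have hC0 : 0 < C := by positivity
  rw [setIntegral_univ, setIntegral_univ, h.integral_p,
    integral_gaussianPDFReal_eq_one 0 one_ne_zero, mul_one] at h1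
  have h2 : ∀ y, |P.real {ω | y < T ω} - p 0 * √(2 * Real.pi) * gaussTail y| ≤ C * δ * p 0 := by
    intro y
    rw [gaussTail_eq_integral, h.real_T_gt]
    exact h.abs_setIntegral_sub_le h' hδ _
  set k := p 0 * √(2 * Real.pi) with hk
  have hk0 : p 0 ≤ k := by
    rw [hk]; exact le_mul_of_one_le_right h0.le one_le_sqrt_two_pi
  have hCδ : 0 < C * δ := by positivity
  have h3 : C * δ * p 0 ≤ 1 / 2 * k := mul_le_mul hδ' hk0 h0.le (by norm_num)
  have hk2 : k ≤ 2 := by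
    have := (abs_le.1 h1).1
    linarith
  have h4 : C * δ * p 0 ≤ 2 * (C * δ) := by nlinarith
  have h5 : |k - 1| ≤ 2 * (C * δ) := by rw [abs_sub_comm]; linarith
  refine ⟨by linarith, fun y => ?_⟩
  have h6 := h2 y
  have q0 := gaussTail_nonneg y
  have q1 := gaussTail_le_one y
  have h7 : |(k - 1) * gaussTail y| ≤ 2 * (C * δ) := by
    rw [abs_mul, abs_of_nonneg q0]
    calc |k - 1| * gaussTail y ≤ |k - 1| * 1 := mul_le_mul_of_nonneg_left q1 (abs_nonneg _)
      _ ≤ _ := by linarith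
  rw [abs_le] at *
  constructor <;> linarith

end ZeroBiasPair

/-! ### Comparison of tails -/

lemma gaussTail_le_exp {b : ℝ} (hb : 0 ≤ b) : gaussTail b ≤ Real.exp (-b ^ 2 / 2) := by
  have h := measure_ge_le_exp_mul_mgf (μ := gaussianReal 0 1) (X := id) b hb
    (integrable_exp_mul_gaussianReal b)
  rw [mgf_id_gaussianReal, ← Real.exp_add] at h
  refine (measureReal_mono ?_).trans (h.trans (Real.exp_le_exp.2 ?_))
  · intro x hx; exact le_of_lt (show b < x from hx)
  · push_cast; nlinarith

lemma gaussTail_neg (y : ℝ) : gaussTail (-y) = 1 - gaussTail y := by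
  have h1 : gaussTail y = ∫ x in Set.Iic (-y), gaussianPDFReal 0 1 x := by
    rw [gaussTail_eq_integral, ← integral_comp_neg_Ioi y (f := gaussianPDFReal 0 1)]
    refine setIntegral_congr_fun measurableSet_Ioi fun x _ => ?_
    simp [gaussianPDFReal]
  have h2 := intervalIntegral.integral_Iic_add_Ioi (b := -y)
    (integrable_gaussianPDFReal 0 1).integrableOn (integrable_gaussianPDFReal 0 1).integrableOn
  rw [integral_gaussianPDFReal_eq_one 0 one_ne_zero] at h2
  rw [h1, gaussTail_eq_integral]
  linarith

lemma continuous_gaussianPDFReal_std : Continuous (gaussianPDFReal 0 1) := by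
  have : gaussianPDFReal 0 1 = fun x => (√(2 * Real.pi))⁻¹ * Real.exp (-x ^ 2 / 2) :=
    funext gaussianPDFReal_std
  rw [this]
  fun_prop

lemma gaussianPDFReal_std_le {x y : ℝ} (h : |x| ≤ |y|) :
    gaussianPDFReal 0 1 y ≤ gaussianPDFReal 0 1 x := by
  rw [gaussianPDFReal_std, gaussianPDFReal_std]
  refine mul_le_mul_of_nonneg_left (Real.exp_le_exp.2 ?_) (inv_nonneg.2 sqrt_two_pi_pos.le)
  have := sq_le_sq.2 h
  linarith

lemma mul_le_gaussTail_sub {u v c : ℝ} (huv : u ≤ v) (hu : -c ≤ u) (hv : v ≤ c) :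
    (v - u) * gaussianPDFReal 0 1 c ≤ gaussTail u - gaussTail v := by
  rw [gaussTail_sub]
  have : ∫ _ in u..v, gaussianPDFReal 0 1 c ≤ ∫ x in u..v, gaussianPDFReal 0 1 x := by
    refine intervalIntegral.integral_mono_on huv (by simp)
      (integrable_gaussianPDFReal 0 1).intervalIntegrable ?_
    intro x hx
    refine gaussianPDFReal_std_le ?_
    rw [abs_of_nonneg (show 0 ≤ c by linarith), abs_le]
    exact ⟨by linarith [hx.1], by linarith [hx.2]⟩
  simpa using this

/-- The constant in front of `δ` in `ZeroBiasPair.berryEsseen`. -/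
noncomputable def berryEsseenConst : ℝ := 4 * (300 * cubeMoment + 14400)

/-- The size of the shift in `quadShift`: large enough to beat the density error `150 δ (1 + y³)`
far from the origin, and the Berry–Esseen error near it. -/
noncomputable def shiftConst : ℝ := 4000 + 4 * berryEsseenConst / gaussianPDFReal 0 1 4

lemma berryEsseenConst_pos : 0 < berryEsseenConst := by
  have := cubeMoment_nonneg
  unfold berryEsseenConst
  positivity

lemma gaussianPDFReal_std_le_one (x : ℝ) : gaussianPDFReal 0 1 x ≤ 1 := by
  rw [gaussianPDFReal_std]
  have h1 : (√(2 * Real.pi))⁻¹ ≤ 1 := inv_le_one_of_one_le₀ one_le_sqrt_two_pi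
  have h2 : Real.exp (-x ^ 2 / 2) ≤ 1 := Real.exp_le_one_iff.2 (by nlinarith [sq_nonneg x])
  have := Real.exp_pos (-x ^ 2 / 2)
  have := inv_pos.2 sqrt_two_pi_pos
  nlinarith

lemma shiftConst_ge : 4000 + 4 * berryEsseenConst ≤ shiftConst := by
  have h1 := gaussianPDFReal_pos 0 1 4 one_ne_zero
  have h2 := gaussianPDFReal_std_le_one 4
  have h3 : 4 * berryEsseenConst ≤ 4 * berryEsseenConst / gaussianPDFReal 0 1 4 := by
    rw [le_div_iff₀ h1]
    nlinarith [berryEsseenConst_pos]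
  unfold shiftConst
  linarith

lemma berryEsseenConst_le : berryEsseenConst ≤ shiftConst * gaussianPDFReal 0 1 4 := by
  have h1 := gaussianPDFReal_pos 0 1 4 one_ne_zero
  have : shiftConst * gaussianPDFReal 0 1 4
      = 4000 * gaussianPDFReal 0 1 4 + 4 * berryEsseenConst := by
    unfold shiftConst; field_simp
  rw [this]
  nlinarith [berryEsseenConst_pos]

/-- The amount by which the argument of the Gaussian tail is moved in order to dominate, or to be
dominated by, the tail of `T` at `y`. -/
noncomputable def quadShift (δ y : ℝ) : ℝ := shiftConst * δ * (1 + y ^ 2)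

lemma exp_neg_two_mul_le {t : ℝ} (ht0 : 0 ≤ t) (ht : t ≤ 1 / 2) : Real.exp (-(2 * t)) ≤ 1 - t := by
  rw [Real.exp_neg, inv_le_comm₀ (Real.exp_pos _) (by linarith)]
  refine le_trans ?_ (Real.add_one_le_exp (2 * t))
  rw [inv_le_iff_one_le_mul₀ (by linarith)]
  nlinarith

/-- The error of `p_le_exp` is absorbed by the change of variables `y ↦ y - quadShift δ y`, up to
the factor `√(2π)`: here `y ≥ 3` makes the gain `y * quadShift δ y` larger than the loss from the
Jacobian `1 - 2 * shiftConst * δ * y`. -/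
lemma shift_upper_density {δ y : ℝ} (hδ : 0 < δ) (hy : 3 ≤ y) (hyδ : 4 * shiftConst * δ * y ≤ 1) :
    Real.exp (berryEsseenConst * δ + (-y ^ 2 / 2 + 150 * δ * (1 + y ^ 3)))
      ≤ Real.exp (-(y - quadShift δ y) ^ 2 / 2) * (1 - 2 * shiftConst * δ * y) := by
  have hB := berryEsseenConst_pos
  have hC := shiftConst_ge
  unfold quadShift
  set B := berryEsseenConst
  set C := shiftConst
  have hC0 : 0 < C := by linarith
  have h1 := exp_neg_two_mul_le (t := 2 * C * δ * y) (by positivity) (by linarith)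
  refine le_trans ?_ (mul_le_mul_of_nonneg_left h1 (Real.exp_pos _).le)
  rw [← Real.exp_add]
  refine Real.exp_le_exp.2 ?_
  set s := C * δ * (1 + y ^ 2) with hs
  have hs0 : 0 ≤ s := by positivity
  have hs1 : s ≤ y / 2 := by
    have e1 : C * δ * y ^ 2 ≤ y / 4 := by nlinarith
    have e2 : C * δ ≤ y / 4 := by
      have : C * δ * 3 ≤ C * δ * y := mul_le_mul_of_nonneg_left hy (by positivity)
      nlinarith
    rw [hs]; linarith
  have hs2 : s * s ≤ s * (y / 2) := mul_le_mul_of_nonneg_left hs1 hs0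
  have key : B + 150 * (1 + y ^ 3) + 4 * C * y ≤ 3 / 4 * (C * (y + y ^ 3)) := by
    have e1 : 9 * y ≤ y ^ 3 := by
      nlinarith [mul_nonneg (show 0 ≤ y by linarith) (show 0 ≤ (y - 3) * (y + 3) by nlinarith)]
    have e2 : C * (9 * y) ≤ C * y ^ 3 := mul_le_mul_of_nonneg_left e1 hC0.le
    have e3 : (4000 + 4 * B) * y ^ 3 ≤ C * y ^ 3 := mul_le_mul_of_nonneg_right hC (by positivity)
    have e4 : 27 ≤ y ^ 3 := by linarith
    have e5 : B * 27 ≤ B * y ^ 3 := mul_le_mul_of_nonneg_left e4 hB.le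
    linarith
  have key' := mul_le_mul_of_nonneg_left key hδ.le
  have e : y * s = δ * (C * (y + y ^ 3)) := by rw [hs]; ring
  nlinarith

lemma shift_lower_density {δ y : ℝ} (hδ : 0 < δ) (hy : 3 ≤ y) :
    Real.exp (-(y + quadShift δ y) ^ 2 / 2) * (1 + 2 * shiftConst * δ * y) ≤
      Real.exp (-(2 * (berryEsseenConst * δ)) + (-y ^ 2 / 2 - 150 * δ * (1 + y ^ 3))) := by
  have hB := berryEsseenConst_pos
  have hC := shiftConst_ge
  unfold quadShift
  set B := berryEsseenConst
  set C := shiftConst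
  have hC0 : 0 < C := by linarith
  have h1 := Real.add_one_le_exp (2 * C * δ * y)
  rw [add_comm] at h1
  refine (mul_le_mul_of_nonneg_left h1 (Real.exp_pos _).le).trans ?_
  rw [← Real.exp_add]
  refine Real.exp_le_exp.2 ?_
  set s := C * δ * (1 + y ^ 2) with hs
  have key : 2 * B + 150 * (1 + y ^ 3) + 2 * C * y ≤ C * (y + y ^ 3) := by
    have e1 : 9 * y ≤ y ^ 3 := by
      nlinarith [mul_nonneg (show 0 ≤ y by linarith) (show 0 ≤ (y - 3) * (y + 3) by nlinarith)]
    have e2 : C * (9 * y) ≤ C * y ^ 3 := mul_le_mul_of_nonneg_left e1 hC0.le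
    have e3 : (4000 + 4 * B) * y ^ 3 ≤ C * y ^ 3 := mul_le_mul_of_nonneg_right hC (by positivity)
    have e4 : 27 ≤ y ^ 3 := by linarith
    have e5 : B * 27 ≤ B * y ^ 3 := mul_le_mul_of_nonneg_left e4 hB.le
    linarith
  have key' := mul_le_mul_of_nonneg_left key hδ.le
  have e : y * s = δ * (C * (y + y ^ 3)) := by rw [hs]; ring
  nlinarith [sq_nonneg s]

/-- At the end `a = 1 / (4 * shiftConst * δ)` of the admissible range the shift is about `a / 4`,
so a crude comparison suffices. -/
lemma shift_upper_boundary {δ a : ℝ} (ha : 10 ≤ a) (haδ : 4 * shiftConst * δ * a = 1) :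
    9 * Real.exp (berryEsseenConst * δ + (-a ^ 2 / 2 + 150 * δ * (1 + a ^ 3)))
      ≤ Real.exp (-(a - quadShift δ a + 1) ^ 2 / 2) := by
  have hB := berryEsseenConst_pos
  have hC := shiftConst_ge
  unfold quadShift
  set B := berryEsseenConst
  set C := shiftConst
  have hC0 : 0 < C := by linarith
  have hδ : 0 < δ := by
    by_contra hc
    have := mul_nonpos_of_nonneg_of_nonpos (show 0 ≤ 4 * C * a by positivity) (not_lt.1 hc)
    linarith
  have h9 : (9 : ℝ) ≤ Real.exp 3 := by
    have h1 := Real.add_one_le_exp (1 : ℝ)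
    have h2 : (Real.exp 3) = (Real.exp 1) ^ 3 := by rw [← Real.exp_nat_mul]; norm_num
    have h3 := Real.exp_one_gt_d9
    rw [h2]
    calc (9 : ℝ) ≤ 2.1 ^ 3 := by norm_num
      _ ≤ _ := by gcongr; linarith
  refine (mul_le_mul_of_nonneg_right h9 (Real.exp_pos _).le).trans ?_
  rw [← Real.exp_add]
  refine Real.exp_le_exp.2 ?_
  have e1 : C * δ * (1 + a ^ 2) = C * δ + a / 4 := by
    have : C * δ * a ^ 2 = (4 * C * δ * a) * a / 4 := by ring
    rw [mul_add, this, haδ]; ring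
  have e2 : 1000 * δ * a ≤ 1 / 16 := by
    have := mul_le_mul_of_nonneg_right (show 4000 ≤ C by linarith) (show 0 ≤ δ * a by positivity)
    nlinarith
  have e3 : B * δ ≤ 1 / 16 := by
    have := mul_le_mul_of_nonneg_right (show 4 * B ≤ C by linarith) (show 0 ≤ δ * a by positivity)
    have : B * δ * 1 ≤ B * δ * a := mul_le_mul_of_nonneg_left (by linarith) (by positivity)
    nlinarith
  have e4 : 150 * δ * (1 + a ^ 3) ≤ 1 / 16 + 1 / 80 * a ^ 2 := by
    have : δ * 1 ≤ δ * a := mul_le_mul_of_nonneg_left (by linarith) hδ.le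
    have : 1000 * δ * a * a ^ 2 ≤ 1 / 16 * a ^ 2 := mul_le_mul_of_nonneg_right e2 (sq_nonneg a)
    nlinarith
  have e5 : 0 < C * δ := by positivity
  have e6 : C * δ ≤ 1 := by
    have : C * δ * 1 ≤ C * δ * a := mul_le_mul_of_nonneg_left (by linarith) (by positivity)
    linarith
  have e7 : (a - C * δ * (1 + a ^ 2) + 1) ^ 2 ≤ (3 / 4 * a + 1) ^ 2 := by
    rw [e1]
    refine pow_le_pow_left₀ (by linarith) (by linarith) 2
  nlinarith

lemma shift_lower_boundary {δ a : ℝ} (ha : 10 ≤ a) (haδ : 4 * shiftConst * δ * a = 1) :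
    Real.exp (-(a + quadShift δ a) ^ 2 / 2)
      ≤ 1 / 6 * Real.exp (-(a + 1) ^ 2 / 2 - 150 * δ * (1 + (a + 1) ^ 3)) := by
  have hB := berryEsseenConst_pos
  have hC := shiftConst_ge
  unfold quadShift
  set B := berryEsseenConst
  set C := shiftConst
  have hC0 : 0 < C := by linarith
  have hδ : 0 < δ := by
    by_contra hc
    have := mul_nonpos_of_nonneg_of_nonpos (show 0 ≤ 4 * C * a by positivity) (not_lt.1 hc)
    linarith
  have h9 : Real.exp (-2) ≤ (1 / 6 : ℝ) := by
    have h2 : (Real.exp 2) = (Real.exp 1) ^ 2 := by rw [← Real.exp_nat_mul]; norm_num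
    have h3 := Real.exp_one_gt_d9
    have h4 : 6 ≤ Real.exp 2 := by
      rw [h2]
      calc (6 : ℝ) ≤ 2.5 ^ 2 := by norm_num
        _ ≤ _ := by gcongr; linarith
    rw [Real.exp_neg, one_div]
    exact inv_anti₀ (by norm_num) h4
  refine le_trans ?_ (mul_le_mul_of_nonneg_right h9 (Real.exp_pos _).le)
  rw [← Real.exp_add]
  refine Real.exp_le_exp.2 ?_
  have e1 : C * δ * (1 + a ^ 2) = C * δ + a / 4 := by
    have : C * δ * a ^ 2 = (4 * C * δ * a) * a / 4 := by ring
    rw [mul_add, this, haδ]; ring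
  have e2 : 1000 * δ * a ≤ 1 / 16 := by
    have := mul_le_mul_of_nonneg_right (show 4000 ≤ C by linarith) (show 0 ≤ δ * a by positivity)
    nlinarith
  have e4 : 150 * δ * (1 + (a + 1) ^ 3) ≤ 1 / 16 + 1 / 40 * a ^ 2 := by
    have q1 : δ * 1 ≤ δ * a := mul_le_mul_of_nonneg_left (by linarith) hδ.le
    have q2 : 1000 * δ * a * a ^ 2 ≤ 1 / 16 * a ^ 2 := mul_le_mul_of_nonneg_right e2 (sq_nonneg a)
    have q3 : (a + 1) ^ 3 ≤ (11 / 10 * a) ^ 3 := pow_le_pow_left₀ (by linarith) (by linarith) 3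
    have q4 : (a + 1) ^ 3 ≤ 2 * a ^ 3 := by
      have : 0 ≤ a ^ 3 := by positivity
      nlinarith
    have q5 := mul_le_mul_of_nonneg_left q4 hδ.le
    nlinarith
  have e5 : 0 < C * δ := by positivity
  have e7 : (5 / 4 * a) ^ 2 ≤ (a + C * δ * (1 + a ^ 2)) ^ 2 := by
    rw [e1]
    refine pow_le_pow_left₀ (by linarith) (by linarith) 2
  nlinarith

namespace ZeroBiasPair

variable {Ω : Type*} [MeasurableSpace Ω] {P : Measure Ω} [IsProbabilityMeasure P]
  {W T : Ω → ℝ} {p : ℝ → ℝ} {δ : ℝ}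

lemma small_of_shiftConst (hδ0 : 0 < δ) (hδ : 40 * shiftConst * δ ≤ 1) :
    δ ≤ 1 / 10000 ∧ (300 * cubeMoment + 14400) * δ ≤ 1 / 2 ∧ berryEsseenConst * δ ≤ 1 / 2 := by
  have hB := berryEsseenConst_pos
  have hC := shiftConst_ge
  have e : berryEsseenConst = 4 * (300 * cubeMoment + 14400) := rfl
  have h1 := mul_le_mul_of_nonneg_right hC hδ0.le
  have h2 : 0 < berryEsseenConst * δ := by positivity
  refine ⟨by nlinarith, ?_, by nlinarith⟩
  have : (300 * cubeMoment + 14400) * δ = berryEsseenConst * δ / 4 := by rw [e]; ring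
  rw [this]; nlinarith

/-- Comparison of densities after the change of variables `ψ x = x - quadShift δ x`, integrated
from `y` to the end `a` of the admissible range; the remaining tails are compared at `a`. -/
lemma tail_upper_far (h : ZeroBiasPair P W T p δ)
    (h' : ZeroBiasPair P (-W) (-T) (fun x => p (-x)) δ) (hδ : 40 * shiftConst * δ ≤ 1)
    {y : ℝ} (hy : 3 ≤ y) (hyδ : 4 * shiftConst * δ * y ≤ 1) :
    P.real {ω | y < T ω} ≤ gaussTail (y - quadShift δ y) := by
  have hp := h.pos
  obtain ⟨d1, d2, d3⟩ := small_of_shiftConst hp hδ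
  obtain ⟨hk, -⟩ := h.berryEsseen h' d1 d2
  rw [show 4 * (300 * cubeMoment + 14400) = berryEsseenConst from rfl] at hk
  have hC := shiftConst_ge
  have hB := berryEsseenConst_pos
  have hC0 : 0 < shiftConst := by linarith
  set k := p 0 * √(2 * Real.pi) with hkd
  have hk1 : k ≤ Real.exp (berryEsseenConst * δ) := by
    have := Real.add_one_le_exp (berryEsseenConst * δ)
    linarith [(abs_le.1 hk).2]
  set a := 1 / (4 * shiftConst * δ) with ha
  have haδ : 4 * shiftConst * δ * a = 1 := by rw [ha]; field_simp
  have hya : y ≤ a := by rw [ha, le_div_iff₀ (by positivity)]; linarith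
  have ha10 : 10 ≤ a := by rw [ha, le_div_iff₀ (by positivity)]; linarith
  have hpk : p 0 = (√(2 * Real.pi))⁻¹ * k := by
    rw [hkd]; field_simp
  have hadm : ∀ x, x ≤ a → x * δ ≤ 1 / 1000 := by
    intro x hx
    have e1 : x * δ ≤ a * δ := mul_le_mul_of_nonneg_right hx hp.le
    have e2 : 4000 * (a * δ) ≤ shiftConst * (a * δ) :=
      mul_le_mul_of_nonneg_right (by linarith) (by positivity)
    linarith
  have hpx : ∀ x, 0 ≤ x → x ≤ a → p x ≤ (√(2 * Real.pi))⁻¹ *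
      Real.exp (berryEsseenConst * δ + (-x ^ 2 / 2 + 150 * δ * (1 + x ^ 3))) := by
    intro x hx0 hxa
    refine (h.p_le_exp (by linarith) hx0 (hadm x hxa)).trans ?_
    rw [hpk, mul_assoc, Real.exp_add (berryEsseenConst * δ)]
    refine mul_le_mul_of_nonneg_left ?_ (inv_nonneg.2 sqrt_two_pi_pos.le)
    exact mul_le_mul_of_nonneg_right hk1 (Real.exp_pos _).le
  have hψ : ∀ x, HasDerivAt (fun x => x - quadShift δ x) (1 - 2 * shiftConst * δ * x) x := by
    intro x
    have := (hasDerivAt_id x).sub (((hasDerivAt_pow 2 x).const_add 1).const_mul (shiftConst * δ))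
    refine HasDerivAt.congr_deriv (f := fun x => x - quadShift δ x) this ?_
    norm_num; ring
  have hint := intervalIntegral.integral_comp_mul_deriv (a := y) (b := a) (fun x _ => hψ x)
    (by fun_prop) continuous_gaussianPDFReal_std
  have h1 : ∫ x in y..a, p x ≤ ∫ x in y..a,
      (gaussianPDFReal 0 1 ∘ fun x => x - quadShift δ x) x * (1 - 2 * shiftConst * δ * x) := by
    refine intervalIntegral.integral_mono_on hya (h.intervalIntegrable_p _ _) ?_ ?_
    · refine Continuous.intervalIntegrable ?_ _ _
      have := continuous_gaussianPDFReal_std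
      unfold quadShift
      fun_prop
    · intro x hx
      refine (hpx x (by linarith [hx.1]) hx.2).trans ?_
      simp only [Function.comp, gaussianPDFReal_std]
      rw [mul_assoc (√(2 * Real.pi))⁻¹]
      refine mul_le_mul_of_nonneg_left ?_ (inv_nonneg.2 sqrt_two_pi_pos.le)
      refine shift_upper_density hp (by linarith [hx.1]) ?_
      rw [← haδ]
      exact mul_le_mul_of_nonneg_left hx.2 (by positivity)
  rw [hint, ← gaussTail_sub] at h1
  have h2 := h.tail_sub_tail y a
  have h3 : P.real {ω | a < T ω} ≤ gaussTail (a - quadShift δ a) := by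
    have e1 := h.real_T_gt_le_p (x := a) (by linarith) (by linarith)
      (by linarith [hadm a le_rfl])
    have e2 := hpx a (by linarith) le_rfl
    have e3 := mul_le_mul_of_nonneg_left (shift_upper_boundary ha10 haδ)
      (inv_nonneg.2 sqrt_two_pi_pos.le)
    rw [← gaussianPDFReal_std] at e3
    have e4 : 0 ≤ a - quadShift δ a := by
      unfold quadShift
      have : shiftConst * δ * (1 + a ^ 2) = shiftConst * δ + a / 4 := by
        have : shiftConst * δ * a ^ 2 = (4 * shiftConst * δ * a) * a / 4 := by ring
        rw [mul_add, this, haδ]; ring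
      rw [this]; linarith
    have e5 := mul_le_gaussTail_sub (u := a - quadShift δ a) (v := a - quadShift δ a + 1)
      (c := a - quadShift δ a + 1) (by linarith) (by linarith) le_rfl
    have e6 := gaussTail_nonneg (a - quadShift δ a + 1)
    linarith
  linarith

lemma tail_lower_far (h : ZeroBiasPair P W T p δ)
    (h' : ZeroBiasPair P (-W) (-T) (fun x => p (-x)) δ) (hδ : 40 * shiftConst * δ ≤ 1)
    {y : ℝ} (hy : 3 ≤ y) (hyδ : 4 * shiftConst * δ * y ≤ 1) :
    gaussTail (y + quadShift δ y) ≤ P.real {ω | y < T ω} := by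
  have hp := h.pos
  obtain ⟨d1, d2, d3⟩ := small_of_shiftConst hp hδ
  obtain ⟨hk, -⟩ := h.berryEsseen h' d1 d2
  rw [show 4 * (300 * cubeMoment + 14400) = berryEsseenConst from rfl] at hk
  have hC := shiftConst_ge
  have hB := berryEsseenConst_pos
  have hC0 : 0 < shiftConst := by linarith
  set k := p 0 * √(2 * Real.pi) with hkd
  have hk1 : Real.exp (-(2 * (berryEsseenConst * δ))) ≤ k := by
    have := exp_neg_two_mul_le (t := berryEsseenConst * δ) (by positivity) d3
    linarith [(abs_le.1 hk).1]
  set a := 1 / (4 * shiftConst * δ) with ha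
  have haδ : 4 * shiftConst * δ * a = 1 := by rw [ha]; field_simp
  have hya : y ≤ a := by rw [ha, le_div_iff₀ (by positivity)]; linarith
  have ha10 : 10 ≤ a := by rw [ha, le_div_iff₀ (by positivity)]; linarith
  have hpk : p 0 = (√(2 * Real.pi))⁻¹ * k := by
    rw [hkd]; field_simp
  have hadm : ∀ x, x ≤ a + 1 → x * δ ≤ 1 / 1000 := by
    intro x hx
    have e1 : x * δ ≤ (a + 1) * δ := mul_le_mul_of_nonneg_right hx hp.le
    have e2 : 4000 * (a * δ) ≤ shiftConst * (a * δ) :=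
      mul_le_mul_of_nonneg_right (by linarith) (by positivity)
    linarith
  have hpx : ∀ x, 0 ≤ x → x ≤ a → (√(2 * Real.pi))⁻¹ *
      Real.exp (-(2 * (berryEsseenConst * δ)) + (-x ^ 2 / 2 - 150 * δ * (1 + x ^ 3))) ≤ p x := by
    intro x hx0 hxa
    refine le_trans ?_ (h.exp_le_p (by linarith) hx0 (hadm x (by linarith)))
    rw [hpk, mul_assoc (√(2 * Real.pi))⁻¹ k, Real.exp_add (-(2 * (berryEsseenConst * δ)))]
    refine mul_le_mul_of_nonneg_left ?_ (inv_nonneg.2 sqrt_two_pi_pos.le)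
    exact mul_le_mul_of_nonneg_right hk1 (Real.exp_pos _).le
  have hψ : ∀ x, HasDerivAt (fun x => x + quadShift δ x) (1 + 2 * shiftConst * δ * x) x := by
    intro x
    have := (hasDerivAt_id x).add (((hasDerivAt_pow 2 x).const_add 1).const_mul (shiftConst * δ))
    refine HasDerivAt.congr_deriv (f := fun x => x + quadShift δ x) this ?_
    norm_num; ring
  have hint := intervalIntegral.integral_comp_mul_deriv (a := y) (b := a) (fun x _ => hψ x)
    (by fun_prop) continuous_gaussianPDFReal_std
  have h1 : ∫ x in y..a, (gaussianPDFReal 0 1 ∘ fun x => x + quadShift δ x) x *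
      (1 + 2 * shiftConst * δ * x) ≤ ∫ x in y..a, p x := by
    refine intervalIntegral.integral_mono_on hya ?_ (h.intervalIntegrable_p _ _) ?_
    · refine Continuous.intervalIntegrable ?_ _ _
      have := continuous_gaussianPDFReal_std
      unfold quadShift
      fun_prop
    · intro x hx
      refine le_trans ?_ (hpx x (by linarith [hx.1]) hx.2)
      simp only [Function.comp, gaussianPDFReal_std]
      rw [mul_assoc (√(2 * Real.pi))⁻¹]
      refine mul_le_mul_of_nonneg_left ?_ (inv_nonneg.2 sqrt_two_pi_pos.le)
      exact shift_lower_density hp (by linarith [hx.1])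
  rw [hint, ← gaussTail_sub] at h1
  have h2 := h.tail_sub_tail y a
  have h3 : gaussTail (a + quadShift δ a) ≤ P.real {ω | a < T ω} := by
    have q : 0 ≤ quadShift δ a := by unfold quadShift; positivity
    have e1 := gaussTail_le_exp (b := a + quadShift δ a) (by linarith)
    have e2 := shift_lower_boundary ha10 haδ
    have e3 := h.exp_le_p (x := a + 1) (by linarith) (by linarith) (hadm _ le_rfl)
    have e4 : 1 / 6 ≤ p 0 := by
      have f1 : √(2 * Real.pi) ≤ 3 := by
        rw [Real.sqrt_le_left (by norm_num)]
        linarith [Real.pi_lt_d2]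
      have f2 : 1 / 2 ≤ k := by linarith [(abs_le.1 hk).1]
      have f3 : k ≤ p 0 * 3 := mul_le_mul_of_nonneg_left f1 h.p_zero_pos.le
      linarith
    have e5 := mul_le_mul_of_nonneg_right e4
      (Real.exp_pos (-(a + 1) ^ 2 / 2 - 150 * δ * (1 + (a + 1) ^ 3))).le
    have e6 : ∫ _ in a..(a + 1), p (a + 1) ≤ ∫ x in a..(a + 1), p x := by
      refine intervalIntegral.integral_mono_on (by linarith) (by simp)
        (h.intervalIntegrable_p _ _) ?_
      intro x hx
      exact h.anti (by linarith [hx.1]) hx.2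
    rw [← h.tail_sub_tail] at e6
    simp only [intervalIntegral.integral_const, add_sub_cancel_left, one_smul] at e6
    have e7 : 0 ≤ P.real {ω | a + 1 < T ω} := measureReal_nonneg
    linarith
  linarith

/-- Near the origin the Gaussian tail moves by at least a constant multiple of the shift, which is
larger than the Berry–Esseen error. -/
lemma tail_central (h : ZeroBiasPair P W T p δ)
    (h' : ZeroBiasPair P (-W) (-T) (fun x => p (-x)) δ) (hδ : 40 * shiftConst * δ ≤ 1)
    {y : ℝ} (hy : |y| ≤ 3) :
    gaussTail (y + quadShift δ y) ≤ P.real {ω | y < T ω} ∧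
      P.real {ω | y < T ω} ≤ gaussTail (y - quadShift δ y) := by
  have hp := h.pos
  obtain ⟨d1, d2, d3⟩ := small_of_shiftConst hp hδ
  obtain ⟨-, hk⟩ := h.berryEsseen h' d1 d2
  rw [show 4 * (300 * cubeMoment + 14400) = berryEsseenConst from rfl] at hk
  have hC := shiftConst_ge
  have hB := berryEsseenConst_pos
  have hC0 : 0 < shiftConst := by linarith
  have h1 := abs_le.1 (hk y)
  have hy2 : y ^ 2 ≤ 9 := by
    rw [← sq_abs]; nlinarith [abs_nonneg y]
  have q1 : quadShift δ y ≤ 1 := by unfold quadShift; nlinarith [mul_pos hC0 hp]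
  have q0 : shiftConst * δ ≤ quadShift δ y := by
    unfold quadShift
    exact le_mul_of_one_le_right (by positivity) (by linarith [sq_nonneg y])
  have q2 : berryEsseenConst * δ ≤ quadShift δ y * gaussianPDFReal 0 1 4 := by
    have e1 := mul_le_mul_of_nonneg_right berryEsseenConst_le hp.le
    have e2 := mul_le_mul_of_nonneg_right q0 (gaussianPDFReal_nonneg 0 1 4)
    linarith
  have q3 : 0 ≤ quadShift δ y := by unfold quadShift; positivity
  have hy' := abs_le.1 hy
  have f1 := mul_le_gaussTail_sub (u := y) (v := y + quadShift δ y) (c := 4) (by linarith)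
    (by linarith) (by linarith)
  have f2 := mul_le_gaussTail_sub (u := y - quadShift δ y) (v := y) (c := 4) (by linarith)
    (by linarith) (by linarith)
  rw [show y + quadShift δ y - y = quadShift δ y by ring] at f1
  rw [show y - (y - quadShift δ y) = quadShift δ y by ring] at f2
  constructor <;> linarith

lemma tail_neg (h : ZeroBiasPair P W T p δ)
    (h' : ZeroBiasPair P (-W) (-T) (fun x => p (-x)) δ) (y : ℝ) :
    P.real {ω | -y < (-T) ω} = 1 - P.real {ω | y < T ω} := by
  rw [h'.real_T_gt, h.real_T_gt, integral_comp_neg_Ioi (f := p), neg_neg]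
  have := intervalIntegral.integral_Iic_add_Ioi (b := y) h.integrable_p.integrableOn
    h.integrable_p.integrableOn
  rw [h.integral_p] at this
  linarith

theorem tail_comparison (h : ZeroBiasPair P W T p δ)
    (h' : ZeroBiasPair P (-W) (-T) (fun x => p (-x)) δ) (hδ : 40 * shiftConst * δ ≤ 1)
    {y : ℝ} (hyδ : 4 * shiftConst * δ * |y| ≤ 1) :
    gaussTail (y + quadShift δ y) ≤ P.real {ω | y < T ω} ∧
      P.real {ω | y < T ω} ≤ gaussTail (y - quadShift δ y) := by
  rcases le_or_gt |y| 3 with hy | hy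
  · exact h.tail_central h' hδ hy
  · -- for negative `y` the two bounds for `(-W, -T)` are complemented and exchange their roles
    rcases lt_abs.1 hy with hy | hy
    · rw [abs_of_pos (by linarith)] at hyδ
      exact ⟨h.tail_lower_far h' hδ hy.le hyδ, h.tail_upper_far h' hδ hy.le hyδ⟩
    · rw [abs_of_neg (by linarith)] at hyδ
      have h'' : ZeroBiasPair P (-(-W)) (-(-T)) (fun x => (fun x => p (-x)) (-x)) δ := by
        simpa using h
      have e := h.tail_neg h' y
      have f1 := h'.tail_lower_far h'' hδ hy.le hyδ
      have f2 := h'.tail_upper_far h'' hδ hy.le hyδ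
      have q : quadShift δ (-y) = quadShift δ y := by simp [quadShift]
      rw [e, q] at f1 f2
      rw [show -y + quadShift δ y = -(y - quadShift δ y) by ring, gaussTail_neg] at f1
      rw [show -y - quadShift δ y = -(y + quadShift δ y) by ring, gaussTail_neg] at f2
      constructor <;> linarith

end ZeroBiasPair

/-! ### Comparison of quantiles -/

/-- The quantile function of `μ`. It is only meaningful on `(0, 1)`, where the infimum is attained;
elsewhere it may take the default value `0` of `sInf`. -/
noncomputable def quantile (μ : Measure ℝ) (u : ℝ) : ℝ := sInf {x | u ≤ cdf μ x}

section Quantile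

variable {μ : Measure ℝ} {u : ℝ}

lemma quantile_le_iff (hu : u ∈ Set.Ioo (0 : ℝ) 1) (x : ℝ) :
    quantile μ u ≤ x ↔ u ≤ cdf μ x := by
  have hne : {x | u ≤ cdf μ x}.Nonempty := by
    obtain ⟨x, hx⟩ := ((tendsto_cdf_atTop μ).eventually (lt_mem_nhds hu.2)).exists
    exact ⟨x, le_of_lt hx⟩
  have hbd : BddBelow {x | u ≤ cdf μ x} := by
    obtain ⟨x, hx⟩ := ((tendsto_cdf_atBot μ).eventually (gt_mem_nhds hu.1)).exists
    refine ⟨x, fun y hy => ?_⟩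
    by_contra hc
    have := monotone_cdf μ (le_of_lt (not_le.1 hc))
    have hy : u ≤ cdf μ y := hy
    linarith
  constructor
  · intro h
    have h1 : ∀ y, x < y → u ≤ cdf μ y := by
      intro y hy
      obtain ⟨z, hz, hzy⟩ := exists_lt_of_csInf_lt hne (lt_of_le_of_lt h hy)
      exact le_trans hz (monotone_cdf μ hzy.le)
    have h2 : Filter.Tendsto (cdf μ) (nhdsWithin x (Set.Ioi x)) (nhds (cdf μ x)) :=
      ((cdf μ).right_continuous x).tendsto.mono_left (nhdsWithin_mono x Set.Ioi_subset_Ici_self)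
    refine ge_of_tendsto h2 ?_
    filter_upwards [self_mem_nhdsWithin] with y hy using h1 y hy
  · intro h
    exact csInf_le hbd h

lemma lt_quantile_iff (hu : u ∈ Set.Ioo (0 : ℝ) 1) (x : ℝ) :
    x < quantile μ u ↔ cdf μ x < u := by
  rw [← not_le, quantile_le_iff hu, not_le]

lemma monotoneOn_quantile : MonotoneOn (quantile μ) (Set.Ioo 0 1) := by
  intro u hu v hv huv
  rw [quantile_le_iff hu]
  exact huv.trans ((quantile_le_iff hv _).1 le_rfl)

lemma aemeasurable_quantile : AEMeasurable (quantile μ) (volume.restrict (Set.Ioo 0 1)) :=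
  aemeasurable_restrict_of_monotoneOn measurableSet_Ioo monotoneOn_quantile

instance isProbabilityMeasure_unitInterval :
    IsProbabilityMeasure ((volume : Measure ℝ).restrict (Set.Ioo 0 1)) :=
  ⟨by simp⟩

lemma map_quantile [IsProbabilityMeasure μ] :
    (volume.restrict (Set.Ioo 0 1)).map (quantile μ) = μ := by
  have := Measure.isProbabilityMeasure_map (aemeasurable_quantile (μ := μ))
  refine Measure.eq_of_cdf _ _ (StieltjesFunction.ext fun x => ?_)
  rw [cdf_eq_real, map_measureReal_apply_of_aemeasurable aemeasurable_quantile measurableSet_Iic]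
  have h1 : (quantile μ ⁻¹' Set.Iic x) ∩ Set.Ioo 0 1 = Set.Iic (cdf μ x) ∩ Set.Ioo 0 1 := by
    ext u
    constructor
    · rintro ⟨h1, h2⟩
      exact ⟨(quantile_le_iff h2 x).1 h1, h2⟩
    · rintro ⟨h1, h2⟩
      exact ⟨(quantile_le_iff h2 x).2 h1, h2⟩
  have h0 := cdf_nonneg μ x
  have h2 := cdf_le_one μ x
  rw [Measure.real, Measure.restrict_apply₀' measurableSet_Ioo.nullMeasurableSet, h1]
  have h3 : (Set.Iic (cdf μ x) ∩ Set.Ioo (0 : ℝ) 1 : Set ℝ) =ᵐ[volume] Set.Ioc 0 (cdf μ x) := by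
    have : (Set.Iic (cdf μ x) ∩ Set.Ioo (0 : ℝ) 1 : Set ℝ)
        =ᵐ[volume] (Set.Iic (cdf μ x) ∩ Set.Ioc (0 : ℝ) 1 : Set ℝ) :=
      (Filter.EventuallyEq.refl _ _).inter Ioo_ae_eq_Ioc
    refine this.trans (Filter.EventuallyEq.of_eq ?_)
    ext u
    constructor
    · rintro ⟨a, b, c⟩; exact ⟨b, a⟩
    · rintro ⟨a, b⟩; exact ⟨b, a, le_trans b h2⟩
  rw [measure_congr h3, Real.volume_Ioc, sub_zero, ENNReal.toReal_ofReal h0]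

end Quantile

lemma cdf_gaussian_eq (x : ℝ) : cdf (gaussianReal 0 1) x = 1 - gaussTail x := by
  rw [cdf_eq_real, gaussTail, ← Set.compl_Iic, probReal_compl_eq_one_sub measurableSet_Iic]
  ring

namespace ZeroBiasPair

variable {Ω : Type*} [MeasurableSpace Ω] {P : Measure Ω} [IsProbabilityMeasure P]
  {W T : Ω → ℝ} {p : ℝ → ℝ} {δ : ℝ}

lemma cdf_map_W (h : ZeroBiasPair P W T p δ) (x : ℝ) :
    cdf (P.map W) x = 1 - P.real {ω | x < W ω} := by
  have := Measure.isProbabilityMeasure_map h.measW.aemeasurable (μ := P)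
  have e : {ω | x < W ω} = (W ⁻¹' Set.Iic x)ᶜ := by
    ext ω; simp
  rw [cdf_eq_real, map_measureReal_apply h.measW measurableSet_Iic, e,
    probReal_compl_eq_one_sub (h.measW measurableSet_Iic)]
  ring

/-- For moderate Gaussian quantiles `z` the tail comparison, inverted, bounds the distance to the
quantile of `W`. -/
lemma abs_quantile_sub_le_near (h : ZeroBiasPair P W T p δ)
    (h' : ZeroBiasPair P (-W) (-T) (fun x => p (-x)) δ) (hδ : 40 * shiftConst * δ ≤ 1)
    {u : ℝ} (hu : u ∈ Set.Ioo (0 : ℝ) 1)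
    (hz : 16 * shiftConst * δ * |quantile (gaussianReal 0 1) u| ≤ 1) :
    |quantile (P.map W) u - quantile (gaussianReal 0 1) u|
      ≤ 5 * shiftConst * δ * (1 + quantile (gaussianReal 0 1) u ^ 2) := by
  have hp := h.pos
  have hC := shiftConst_ge
  have hB := berryEsseenConst_pos
  have hC0 : 0 < shiftConst := by linarith
  set w := quantile (P.map W) u with hw
  set z := quantile (gaussianReal 0 1) u with hzd
  -- the shift at `z ± t` is smaller than `t`, so that `z ± t` corrects the quantile past `z`
  set t := 4 * shiftConst * δ * (1 + z ^ 2) with ht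
  have ht0 : 0 ≤ t := by positivity
  have hcd : 0 < shiftConst * δ := by positivity
  have ht1 : t ≤ 1 / 10 + |z| / 4 := by
    have : 16 * shiftConst * δ * |z| * |z| ≤ 1 * |z| :=
      mul_le_mul_of_nonneg_right hz (abs_nonneg z)
    have e : z ^ 2 = |z| * |z| := by rw [← sq_abs]; ring
    rw [ht, e]; nlinarith
  have ht2 : t ^ 2 ≤ 1 / 50 + z ^ 2 / 8 := by
    have := pow_le_pow_left₀ ht0 ht1 2
    rw [← sq_abs z]
    nlinarith [sq_nonneg (1 / 10 - |z| / 4)]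
  have hs : ∀ y, y ^ 2 ≤ 2 * z ^ 2 + 2 * t ^ 2 → quadShift δ y < t := by
    intro y hy
    unfold quadShift
    have : 1 + y ^ 2 < 4 * (1 + z ^ 2) := by nlinarith [sq_nonneg z]
    have := mul_lt_mul_of_pos_left this hcd
    rw [ht]; linarith
  have hadm : ∀ y, |y| ≤ |z| + t → 4 * shiftConst * δ * |y| ≤ 1 := by
    intro y hy
    have e1 : |y| ≤ 5 / 4 * |z| + 1 / 10 := by linarith
    have := mul_le_mul_of_nonneg_left e1 hcd.le
    nlinarith
  have hup : w ≤ z + t + δ := by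
    rw [hw, quantile_le_iff hu, h.cdf_map_W]
    have e1 := (h.tail_comparison h' hδ (y := z + t)
      (hadm _ ((abs_add_le _ _).trans (by rw [abs_of_nonneg ht0])))).2
    have e2 := h.real_W_gt_le (z + t + δ)
    rw [add_sub_cancel_right] at e2
    have e3 := hs (z + t) (by nlinarith [sq_nonneg (z - t)])
    have e4 := gaussTail_antitone (show z ≤ z + t - quadShift δ (z + t) by linarith)
    have e5 := (quantile_le_iff hu z (μ := gaussianReal 0 1)).1 le_rfl
    rw [cdf_gaussian_eq] at e5
    linarith
  have hlow : z - t - δ < w := by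
    rw [hw, lt_quantile_iff hu, h.cdf_map_W]
    have e1 := (h.tail_comparison h' hδ (y := z - t)
      (hadm _ ((abs_sub _ _).trans (by rw [abs_of_nonneg ht0])))).1
    have e2 := h.real_T_gt_le (z - t)
    have e3 := hs (z - t) (by nlinarith [sq_nonneg (z + t)])
    have e5 := (lt_quantile_iff hu (z - t + quadShift δ (z - t)) (μ := gaussianReal 0 1)).1
      (by rw [← hzd]; linarith)
    rw [cdf_gaussian_eq] at e5
    linarith
  have hfin : t + δ ≤ 5 * shiftConst * δ * (1 + z ^ 2) := by
    have : δ ≤ shiftConst * δ * (1 + z ^ 2) := by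
      have e1 : 1 ≤ shiftConst * (1 + z ^ 2) := by
        nlinarith [sq_nonneg z, mul_nonneg hC0.le (sq_nonneg z)]
      nlinarith
    rw [ht]; linarith
  rw [abs_le]
  constructor <;> linarith

lemma abs_quantile_map_le (h : ZeroBiasPair P W T p δ) {M : ℝ} (hM : ∀ᵐ ω ∂P, |W ω| ≤ M)
    {u : ℝ} (hu : u ∈ Set.Ioo (0 : ℝ) 1) : |quantile (P.map W) u| ≤ M := by
  rw [abs_le]
  constructor
  · by_contra hc
    have h1 := (quantile_le_iff hu (quantile (P.map W) u) (μ := P.map W)).1 le_rfl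
    rw [h.cdf_map_W] at h1
    have h2 : P.real {ω | quantile (P.map W) u < W ω} = 1 := by
      have : {ω | quantile (P.map W) u < W ω} =ᵐ[P] Set.univ := by
        refine Filter.eventuallyEq_univ.2 ?_
        filter_upwards [hM] with ω hω
        have := (abs_le.1 hω).1
        show _ < W ω
        linarith
      rw [measureReal_congr this, probReal_univ]
    rw [h2] at h1
    linarith [hu.1]
  · rw [quantile_le_iff hu, h.cdf_map_W]
    have h2 : P.real {ω | M < W ω} = 0 := by
      rw [measureReal_eq_zero_iff]
      refine measure_mono_null (t := {ω | ¬ |W ω| ≤ M}) ?_ hM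
      intro ω hω
      have hω : M < W ω := hω
      show ¬ |W ω| ≤ M
      rw [not_le]
      exact hω.trans_le (le_abs_self _)
    rw [h2]
    linarith [hu.2]

/-- The quantiles of `W` and of the standard normal law differ by `O(δ (1 + z²))` for every level.
Where the tail comparison does not apply, either `δ` is bounded below or `|z|` is at least of order
`1 / δ`, and the boundedness of `W` gives the estimate. -/
theorem abs_quantile_sub_le (h : ZeroBiasPair P W T p δ)
    (h' : ZeroBiasPair P (-W) (-T) (fun x => p (-x)) δ) {M : ℝ} (hM0 : 0 ≤ M)
    (hM : ∀ᵐ ω ∂P, |W ω| ≤ M / δ) {u : ℝ} (hu : u ∈ Set.Ioo (0 : ℝ) 1) :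
    |quantile (P.map W) u - quantile (gaussianReal 0 1) u|
      ≤ 1600 * shiftConst ^ 2 * (M + 1) * δ * (1 + quantile (gaussianReal 0 1) u ^ 2) := by
  have hp := h.pos
  have hC := shiftConst_ge
  have hB := berryEsseenConst_pos
  have hC1 : 1 ≤ shiftConst := by linarith
  have hw := h.abs_quantile_map_le hM hu
  have h3 := abs_sub (quantile (P.map W) u) (quantile (gaussianReal 0 1) u)
  have near := h.abs_quantile_sub_le_near h' (u := u)
  set C := shiftConst
  set w := quantile (P.map W) u with hwd
  set z := quantile (gaussianReal 0 1) u with hzd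
  have hCC : C ≤ C ^ 2 := by nlinarith
  have hz1 : |z| ≤ 1 + z ^ 2 := by rw [← sq_abs]; nlinarith [sq_nonneg (|z| - 1)]
  -- in the remaining cases `1 / δ` is at most a multiple of `1 + |z|`
  have hr : δ * (1 / δ) = 1 := by field_simp
  have hwz : |w - z| ≤ M * (1 / δ) + |z| := by
    rw [mul_one_div]; linarith
  have hr0 : 0 < 1 / δ := by positivity
  set r := 1 / δ with hrd
  have e0 : M * r = δ * (M * r ^ 2) := by
    calc M * r = M * r * (δ * r) := by rw [hr, mul_one]
      _ = _ := by ring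
  have e1 : |z| = δ * (r * |z|) := by rw [← mul_assoc, hr, one_mul]
  have far : M * r ^ 2 + r * |z| ≤ 1600 * C ^ 2 * (M + 1) * (1 + z ^ 2) →
      |w - z| ≤ 1600 * C ^ 2 * (M + 1) * δ * (1 + z ^ 2) := by
    intro hh
    have := mul_le_mul_of_nonneg_left hh hp.le
    linarith
  have hz2 := sq_nonneg z
  have hC2 := sq_nonneg C
  by_cases c1 : 40 * C * δ ≤ 1
  · by_cases c2 : 16 * C * δ * |z| ≤ 1
    · refine (near c1 hu c2).trans ?_
      refine mul_le_mul_of_nonneg_right (mul_le_mul_of_nonneg_right ?_ hp.le) (by positivity)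
      nlinarith [mul_nonneg hC2 hM0]
    · refine far ?_
      have hrz : r ≤ 16 * C * |z| := by
        rw [hrd, div_le_iff₀ hp]; linarith
      have f1 : r ^ 2 ≤ (16 * C * |z|) ^ 2 := pow_le_pow_left₀ hr0.le hrz 2
      rw [mul_pow, sq_abs] at f1
      have f2 := mul_le_mul_of_nonneg_left f1 hM0
      have f3 := mul_le_mul_of_nonneg_right hrz (abs_nonneg z)
      rw [mul_assoc (16 * C), ← sq, sq_abs] at f3
      have f4 : C * z ^ 2 ≤ C ^ 2 * z ^ 2 := mul_le_mul_of_nonneg_right hCC hz2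
      have f5 : 0 ≤ C ^ 2 * z ^ 2 * M := by positivity
      have f6 : 0 ≤ C ^ 2 * M := by positivity
      nlinarith
  · refine far ?_
    have hrz : r ≤ 40 * C := by
      rw [hrd, div_le_iff₀ hp]; linarith
    have f1 : r ^ 2 ≤ (40 * C) ^ 2 := pow_le_pow_left₀ hr0.le hrz 2
    have f2 := mul_le_mul_of_nonneg_left f1 hM0
    have f3 : r * |z| ≤ 40 * C ^ 2 * (1 + z ^ 2) :=
      mul_le_mul (by linarith) hz1 (abs_nonneg z) (by positivity)
    have f5 : 0 ≤ C ^ 2 * z ^ 2 * M := by positivity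
    have f6 : 0 ≤ C ^ 2 * z ^ 2 := by positivity
    nlinarith

end ZeroBiasPair

/-! ### The zero-bias law of a convolution power -/

namespace ZeroBiasPair

variable {Ω : Type*} [MeasurableSpace Ω] {P : Measure Ω}
  {W T : Ω → ℝ} {p : ℝ → ℝ} {δ : ℝ}

lemma setIntegral_gt_nonneg (hW : Measurable W) (hI : Integrable W P) (h0 : ∫ ω, W ω ∂P = 0)
    (x : ℝ) : 0 ≤ ∫ ω in {ω | x < W ω}, W ω ∂P := by
  have m1 : MeasurableSet {ω | x < W ω} := measurableSet_lt measurable_const hW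
  rcases le_total 0 x with hx | hx
  · refine setIntegral_nonneg m1 fun ω hω => ?_
    have hω : x < W ω := hω
    linarith
  · have h1 := integral_add_compl m1 hI
    have h2 : ∫ ω in {ω | x < W ω}ᶜ, W ω ∂P ≤ 0 := by
      refine setIntegral_nonpos m1.compl fun ω hω => ?_
      have hω : ¬ x < W ω := hω
      linarith [not_lt.1 hω]
    linarith

lemma setIntegral_gt_le (hW : Measurable W) (hI : Integrable W P) (x : ℝ) :
    ∫ ω in {ω | x < W ω}, W ω ∂P ≤ ∫ ω in {ω | 0 < W ω}, W ω ∂P := by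
  have m1 : MeasurableSet {ω | x < W ω} := measurableSet_lt measurable_const hW
  have m2 : MeasurableSet {ω | 0 < W ω} := measurableSet_lt measurable_const hW
  rw [← integral_indicator m1, ← integral_indicator m2]
  refine integral_mono (hI.indicator m1) (hI.indicator m2) fun ω => ?_
  by_cases h2 : 0 < W ω
  · rw [Set.indicator_of_mem (show ω ∈ {ω | 0 < W ω} from h2)]
    exact Set.indicator_le_self' (fun _ _ => h2.le) ω
  · rw [Set.indicator_of_notMem (show ω ∉ {ω | 0 < W ω} from h2)]
    exact Set.indicator_apply_nonpos fun _ => not_lt.1 h2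

variable [IsProbabilityMeasure P]

/-- A centred bounded `W` and a `δ`-close `T` with density `E[W; W > x]` form a `ZeroBiasPair`. -/
lemma of_density (hW : Measurable W) (hT : Measurable T) (hδ : 0 < δ)
    (hc : ∀ᵐ ω ∂P, |W ω - T ω| ≤ δ) (hb : ∃ M, ∀ᵐ ω ∂P, |W ω| ≤ M) (h0 : ∫ ω, W ω ∂P = 0)
    (hp : Measurable p) (hpe : ∀ x, p x = ∫ ω in {ω | x < W ω}, W ω ∂P)
    (hl : P.map T = volume.withDensity (fun x => ENNReal.ofReal (p x))) :
    ZeroBiasPair P W T p δ := by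
  have hI : Integrable W P := by
    obtain ⟨M, hM⟩ := hb
    exact Integrable.of_bound hW.aestronglyMeasurable M (by simpa using hM)
  refine ⟨hW, hT, hδ, hc, hb, hp, fun x => ?_, fun x => ?_, fun x _ => (hpe x).ge, fun x hx => ?_,
    hl⟩
  · rw [hpe]; exact setIntegral_gt_nonneg hW hI h0 x
  · rw [hpe, hpe]; exact setIntegral_gt_le hW hI x
  · rw [hpe]
    refine setIntegral_mono_set hI.integrableOn ?_ (ae_of_all _ fun ω hω => le_of_lt hω)
    refine (ae_restrict_iff' (measurableSet_le measurable_const hW)).2 (ae_of_all _ fun ω hω => ?_)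
    exact le_trans hx hω

/-- The reflection of `of_density`: as `W` is centred, `E[W; W > -x] = E[-W; -W ≥ x]`. -/
lemma of_density_neg (hW : Measurable W) (hT : Measurable T) (hδ : 0 < δ)
    (hc : ∀ᵐ ω ∂P, |W ω - T ω| ≤ δ) (hb : ∃ M, ∀ᵐ ω ∂P, |W ω| ≤ M) (h0 : ∫ ω, W ω ∂P = 0)
    (hp : Measurable p) (hpe : ∀ x, p x = ∫ ω in {ω | x < W ω}, W ω ∂P)
    (hl : P.map T = volume.withDensity (fun x => ENNReal.ofReal (p x))) :
    ZeroBiasPair P (-W) (-T) (fun x => p (-x)) δ := by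
  have hI : Integrable W P := by
    obtain ⟨M, hM⟩ := hb
    exact Integrable.of_bound hW.aestronglyMeasurable M (by simpa using hM)
  have key : ∀ x, p (-x) = ∫ ω in {ω | x ≤ (-W) ω}, (-W) ω ∂P := by
    intro x
    have m1 : MeasurableSet {ω | -x < W ω} := measurableSet_lt measurable_const hW
    have h1 := integral_add_compl m1 hI
    have h2 : {ω | -x < W ω}ᶜ = {ω | x ≤ (-W) ω} := by
      ext ω
      show ¬ (-x < W ω) ↔ x ≤ - W ω
      rw [not_lt, le_neg]
    rw [h2, h0] at h1
    simp only [Pi.neg_apply, integral_neg, hpe] at h1 ⊢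
    linarith
  refine ⟨hW.neg, hT.neg, hδ, ?_, ?_, hp.comp measurable_neg, fun x => ?_, fun x => ?_,
    fun x hx => ?_, fun x _ => (key x).le, ?_⟩
  · filter_upwards [hc] with ω hω
    simp only [Pi.neg_apply]
    rwa [show -W ω - -T ω = -(W ω - T ω) by ring, abs_neg]
  · obtain ⟨M, hM⟩ := hb
    exact ⟨M, by simpa using hM⟩
  · rw [hpe]; exact setIntegral_gt_nonneg hW hI h0 _
  · rw [neg_zero, hpe, hpe]; exact setIntegral_gt_le hW hI _
  · rw [key]
    refine setIntegral_mono_set hI.neg.integrableOn ?_ (ae_of_all _ fun ω hω => le_of_lt hω)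
    refine (ae_restrict_iff' (measurableSet_le measurable_const hW.neg)).2
      (ae_of_all _ fun ω hω => ?_)
    exact le_trans hx hω
  · have e : P.map (-T) = (P.map T).map Neg.neg := by
      rw [Measure.map_map measurable_neg hT]; rfl
    rw [e, hl]
    ext s hs
    rw [Measure.map_apply measurable_neg hs, withDensity_apply _ hs,
      withDensity_apply _ (measurable_neg hs), ← lintegral_indicator hs,
      ← lintegral_indicator (measurable_neg hs)]
    rw [← lintegral_neg_eq_self]
    refine lintegral_congr fun x => ?_
    by_cases hx : x ∈ s
    · rw [Set.indicator_of_mem hx, Set.indicator_of_mem (by simpa using hx)]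
    · rw [Set.indicator_of_notMem hx, Set.indicator_of_notMem (by simpa using hx)]

end ZeroBiasPair

/-- The `k`-fold convolution power of `μ`, the law of a sum of `k` independent copies. -/
noncomputable def convPow (μ : Measure ℝ) : ℕ → Measure ℝ
  | 0 => Measure.dirac 0
  | k + 1 => (convPow μ k).conv μ

/-- The truncated first moment `∫_{s > t} s dμ(s)`; for a centred `μ` of variance one it is the
density of the zero-bias law of `μ`. -/
noncomputable def upperMoment (μ : Measure ℝ) (t : ℝ) : ℝ := ∫ s in Set.Ioi t, s ∂μ

section Concrete

variable {μ : Measure ℝ} {b : ℝ}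

lemma convPow_ae_abs_le (hb : ∀ᵐ x ∂μ, |x| ≤ b) (k : ℕ) : ∀ᵐ x ∂(convPow μ k), |x| ≤ k * b := by
  induction k with
  | zero => simp [convPow, ae_dirac_eq]
  | succ k ih =>
    unfold convPow Measure.conv
    rw [ae_map_iff (by fun_prop) (measurableSet_le (by fun_prop) (by fun_prop))]
    filter_upwards [Measure.quasiMeasurePreserving_fst.ae ih,
      Measure.quasiMeasurePreserving_snd.ae hb] with z h1 h2
    refine (abs_add_le _ _).trans ?_
    push_cast
    linarith

lemma upperMoment_eq_integral (t : ℝ) :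
    upperMoment μ t = ∫ s, (Set.Ioi t).indicator (fun s => s) s ∂μ := by
  rw [integral_indicator measurableSet_Ioi]; rfl

lemma abs_upperMoment_le (hI : Integrable (fun x => x) μ) (t : ℝ) :
    |upperMoment μ t| ≤ ∫ s, |s| ∂μ := by
  refine abs_integral_le_integral_abs.trans ?_
  exact setIntegral_le_integral hI.abs (ae_of_all _ fun _ => abs_nonneg _)

variable [IsProbabilityMeasure μ]

instance isProbabilityMeasure_convPow (k : ℕ) : IsProbabilityMeasure (convPow μ k) := by
  induction k with
  | zero => unfold convPow; infer_instance
  | succ k ih => unfold convPow; infer_instance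

lemma integrable_id_convPow (hb : ∀ᵐ x ∂μ, |x| ≤ b) (k : ℕ) :
    Integrable (fun x => x) (convPow μ k) :=
  Integrable.of_bound measurable_id.aestronglyMeasurable (k * b)
    (by simpa using convPow_ae_abs_le hb k)

lemma measurable_upperMoment : Measurable (upperMoment μ) := by
  have : upperMoment μ = fun t =>
      ∫ s, {z : ℝ × ℝ | z.1 < z.2}.indicator (fun z => z.2) (t, s) ∂μ := by
    funext t
    rw [upperMoment_eq_integral]
    rfl
  rw [this]
  refine (StronglyMeasurable.integral_prod_right' (ν := μ)
    (f := {z : ℝ × ℝ | z.1 < z.2}.indicator (fun z => z.2)) ?_).measurable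
  exact (measurable_snd.indicator
    (measurableSet_lt measurable_fst measurable_snd)).stronglyMeasurable

lemma integrable_upperMoment_comp (hI : Integrable (fun x => x) μ) {α : Type*} [MeasurableSpace α]
    {ν : Measure α} [IsFiniteMeasure ν] {f : α → ℝ} (hf : Measurable f) :
    Integrable (fun a => upperMoment μ (f a)) ν :=
  Integrable.of_bound (measurable_upperMoment.comp hf).aestronglyMeasurable (∫ s, |s| ∂μ)
    (ae_of_all _ fun _ => abs_upperMoment_le hI _)

/-- Splitting `(a + b) 1(a + b > x)` into its two summands: if the truncated moment of `ν` is a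
smoothing of that of `μ`, then so is the truncated moment of `ν ∗ μ`. -/
lemma upperMoment_conv {ν ν' : Measure ℝ} [IsProbabilityMeasure ν] [IsProbabilityMeasure ν']
    (hμ : Integrable (fun x => x) μ) (hν : Integrable (fun x => x) ν) {c : ℝ}
    (h : ∀ x, upperMoment ν x = c * ∫ a, upperMoment μ (x - a) ∂ν') (x : ℝ) :
    upperMoment (ν.conv μ) x = c * ∫ a, upperMoment μ (x - a) ∂(ν'.conv μ) +
      ∫ a, upperMoment μ (x - a) ∂ν := by
  have i1 : Integrable (fun z : ℝ × ℝ => {z : ℝ × ℝ | x < z.1 + z.2}.indicator (fun z => z.1) z)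
      (ν.prod μ) := (hν.comp_fst μ).indicator (measurableSet_lt (by fun_prop) (by fun_prop))
  have i2 : Integrable (fun z : ℝ × ℝ => {z : ℝ × ℝ | x < z.1 + z.2}.indicator (fun z => z.2) z)
      (ν.prod μ) := (hμ.comp_snd ν).indicator (measurableSet_lt (by fun_prop) (by fun_prop))
  have e1 : upperMoment (ν.conv μ) x =
      ∫ z : ℝ × ℝ, ({z : ℝ × ℝ | x < z.1 + z.2}.indicator (fun z => z.1) z +
        {z : ℝ × ℝ | x < z.1 + z.2}.indicator (fun z => z.2) z) ∂(ν.prod μ) := by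
    rw [upperMoment_eq_integral, Measure.conv, integral_map (by fun_prop)
      (f := (Set.Ioi x).indicator fun s => s)
      (measurable_id.indicator measurableSet_Ioi).aestronglyMeasurable]
    refine integral_congr_ae (ae_of_all _ fun z => ?_)
    by_cases hz : x < z.1 + z.2
    · simp [Set.indicator, hz]
    · simp [Set.indicator, hz]
  rw [e1, integral_add i1 i2, integral_prod_symm _ i1, integral_prod _ i2]
  congr 1
  · have e2 : ∀ y, ∫ a, {z : ℝ × ℝ | x < z.1 + z.2}.indicator (fun z => z.1) (a, y) ∂ν
        = c * ∫ a, upperMoment μ (x - (y + a)) ∂ν' := by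
      intro y
      rw [show ∫ a, upperMoment μ (x - (y + a)) ∂ν' = ∫ a, upperMoment μ (x - y - a) ∂ν' by
        simp only [sub_sub], ← h, upperMoment_eq_integral]
      refine integral_congr_ae (ae_of_all _ fun a => ?_)
      simp [Set.indicator, sub_lt_iff_lt_add]
    simp only [e2]
    rw [integral_const_mul, Measure.conv_comm, integral_conv]
    exact integrable_upperMoment_comp hμ (by fun_prop)
  · refine integral_congr_ae (ae_of_all _ fun a => ?_)
    simp only [upperMoment_eq_integral]
    refine integral_congr_ae (ae_of_all _ fun s => ?_)
    simp [Set.indicator, sub_lt_iff_lt_add']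

/-- The zero-bias law of a sum of `k + 1` independent copies: replace one summand by its zero-bias
version. -/
lemma upperMoment_convPow (hb : ∀ᵐ x ∂μ, |x| ≤ b) (k : ℕ) (x : ℝ) :
    upperMoment (convPow μ (k + 1)) x
      = (k + 1) * ∫ a, upperMoment μ (x - a) ∂(convPow μ k) := by
  have hμ : Integrable (fun x => x) μ :=
    Integrable.of_bound measurable_id.aestronglyMeasurable b (by simpa using hb)
  induction k generalizing x with
  | zero => simp [convPow]
  | succ k ih =>
    have := upperMoment_conv (ν := convPow μ (k + 1)) (ν' := convPow μ k) hμ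
      (integrable_id_convPow hb _) ih x
    rw [convPow, this]
    push_cast
    rw [← convPow]
    ring

end Concrete

/-! ### Quantiles of normalised sums and gluing of couplings -/

section Concrete

variable {μ : Measure ℝ} {b : ℝ}

lemma conv_withDensity_ofReal {ν : Measure ℝ} [IsProbabilityMeasure ν] {g : ℝ → ℝ}
    (hg : Measurable g) (hg0 : ∀ x, 0 ≤ g x)
    (hi : ∀ y, Integrable (fun a => g (y - a)) ν) :
    ν.conv (volume.withDensity fun x => ENNReal.ofReal (g x))
      = volume.withDensity fun y => ENNReal.ofReal (∫ a, g (y - a) ∂ν) := by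
  ext s hs
  have mi : Measurable (s.indicator (fun _ => (1 : ENNReal))) := measurable_const.indicator hs
  rw [← lintegral_indicator_one hs, Pi.one_def, Measure.lintegral_conv mi,
    withDensity_apply _ hs, ← lintegral_indicator hs]
  have e1 : ∀ a, ∫⁻ c, s.indicator (fun _ => (1 : ENNReal)) (a + c)
      ∂(volume.withDensity fun x => ENNReal.ofReal (g x))
      = ∫⁻ y, ENNReal.ofReal (g (y - a)) * s.indicator (fun _ => (1 : ENNReal)) y := by
    intro a
    rw [lintegral_withDensity_eq_lintegral_mul _ hg.ennreal_ofReal (by fun_prop),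
      ← lintegral_add_left_eq_self
        (fun y => ENNReal.ofReal (g (y - a)) * s.indicator (fun _ => (1 : ENNReal)) y) a]
    simp
  simp only [e1]
  rw [lintegral_lintegral_swap (by fun_prop)]
  refine lintegral_congr fun y => ?_
  by_cases hy : y ∈ s
  · simp only [Set.indicator_of_mem hy, mul_one]
    rw [ofReal_integral_eq_lintegral_ofReal (hi y) (ae_of_all _ fun a => hg0 _)]
  · simp [Set.indicator_of_notMem hy]

lemma upperMoment_eq_zero (hb : ∀ᵐ x ∂μ, |x| ≤ b) (h0 : ∫ x, x ∂μ = 0) {t : ℝ}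
    (ht : t ∉ Set.Ioc (-b) b) (ht' : t ≠ -b) : upperMoment μ t = 0 := by
  rw [upperMoment_eq_integral]
  by_cases h : t ≤ -b
  · have h : t < -b := lt_of_le_of_ne h ht'
    rw [← h0]
    refine integral_congr_ae ?_
    filter_upwards [hb] with s hs
    rw [Set.indicator_of_mem]
    exact lt_of_lt_of_le h (abs_le.1 hs).1
  · have h1 : b < t := by
      by_contra hc
      exact ht ⟨not_le.1 h, not_lt.1 hc⟩
    refine integral_eq_zero_of_ae ?_
    filter_upwards [hb] with s hs
    rw [Set.indicator_of_notMem]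
    · rfl
    · have := (abs_le.1 hs).2
      simp only [Set.mem_Ioi, not_lt]
      linarith

lemma upperMoment_ae_eq (hb : ∀ᵐ x ∂μ, |x| ≤ b) (h0 : ∫ x, x ∂μ = 0) :
    upperMoment μ =ᵐ[volume] (Set.Ioc (-b) b).indicator (upperMoment μ) := by
  have : ∀ᵐ t : ℝ, t ≠ -b := by simp [ae_iff]
  filter_upwards [this] with t ht
  by_cases h : t ∈ Set.Ioc (-b) b
  · rw [Set.indicator_of_mem h]
  · rw [Set.indicator_of_notMem h, upperMoment_eq_zero hb h0 h ht]

variable [IsProbabilityMeasure μ]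

lemma integrable_id_of_bdd (hb : ∀ᵐ x ∂μ, |x| ≤ b) : Integrable (fun x => x) μ :=
  Integrable.of_bound measurable_id.aestronglyMeasurable b (by simpa using hb)

lemma upperMoment_nonneg (hb : ∀ᵐ x ∂μ, |x| ≤ b) (h0 : ∫ x, x ∂μ = 0) (t : ℝ) :
    0 ≤ upperMoment μ t :=
  ZeroBiasPair.setIntegral_gt_nonneg measurable_id (integrable_id_of_bdd hb) h0 t

lemma integrable_upperMoment (hb : ∀ᵐ x ∂μ, |x| ≤ b) (h0 : ∫ x, x ∂μ = 0) :
    Integrable (upperMoment μ) := by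
  rw [integrable_congr (upperMoment_ae_eq hb h0), integrable_indicator_iff measurableSet_Ioc]
  exact integrable_upperMoment_comp (integrable_id_of_bdd hb) measurable_id

/-- The total mass of the zero-bias density is the variance. By Fubini it is `∫ s (s + b) dμ(s)`,
and `μ` is centred. -/
lemma integral_upperMoment (hb : ∀ᵐ x ∂μ, |x| ≤ b) (h0 : ∫ x, x ∂μ = 0) :
    ∫ t, upperMoment μ t = ∫ x, x ^ 2 ∂μ := by
  have hI := integrable_id_of_bdd hb
  have hI2 : Integrable (fun x => x ^ 2) μ := by
    refine Integrable.of_bound (by fun_prop) (b ^ 2) ?_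
    filter_upwards [hb] with x hx
    rw [Real.norm_eq_abs, abs_pow]
    exact pow_le_pow_left₀ (abs_nonneg _) hx 2
  rw [integral_congr_ae (upperMoment_ae_eq hb h0), integral_indicator measurableSet_Ioc]
  have i1 : Integrable (fun z : ℝ × ℝ => {z : ℝ × ℝ | z.1 < z.2}.indicator (fun z => z.2) z)
      ((volume.restrict (Set.Ioc (-b) b)).prod μ) :=
    (hI.comp_snd _).indicator (measurableSet_lt (by fun_prop) (by fun_prop))
  have e1 : ∀ t, upperMoment μ t
      = ∫ s, {z : ℝ × ℝ | z.1 < z.2}.indicator (fun z => z.2) (t, s) ∂μ := fun t => by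
    rw [upperMoment_eq_integral]; rfl
  simp only [e1]
  rw [integral_integral_swap (f := fun t s =>
    {z : ℝ × ℝ | z.1 < z.2}.indicator (fun z => z.2) (t, s)) i1]
  have e2 : ∀ᵐ s ∂μ, ∫ t in Set.Ioc (-b) b,
      {z : ℝ × ℝ | z.1 < z.2}.indicator (fun z => z.2) (t, s) = s ^ 2 + b * s := by
    filter_upwards [hb] with s hs
    have hs' := abs_le.1 hs
    have : ∀ t, {z : ℝ × ℝ | z.1 < z.2}.indicator (fun z => z.2) (t, s)
        = (Set.Iio s).indicator (fun _ => s) t := fun t => rfl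
    simp only [this]
    rw [setIntegral_indicator measurableSet_Iio, setIntegral_const, smul_eq_mul]
    have : (Set.Ioc (-b) b ∩ Set.Iio s : Set ℝ) =ᵐ[volume] Set.Ioc (-b) s := by
      refine (((Filter.EventuallyEq.refl _ _).inter Iio_ae_eq_Iic).trans
        (Filter.EventuallyEq.of_eq ?_))
      ext t
      constructor
      · rintro ⟨⟨h1, h2⟩, h3⟩; exact ⟨h1, h3⟩
      · rintro ⟨h1, h2⟩; exact ⟨⟨h1, le_trans h2 hs'.2⟩, h2⟩
    rw [measureReal_congr this, Real.volume_real_Ioc_of_le (by linarith)]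
    ring
  rw [integral_congr_ae e2, integral_add hI2 (hI.const_mul b), integral_const_mul, h0]
  ring

/-- Quantile comparison for a normalised sum: if `μ` is supported in `[-b, b]`, the sum of `m + 1`
copies and the sum with its last copy replaced by a zero-biased one are at distance at most
`2 b`. -/
theorem abs_quantile_convPow_sub_le (m : ℕ) (hb0 : 0 < b) (hb : ∀ᵐ x ∂μ, |x| ≤ b)
    (h0 : ∫ x, x ∂μ = 0) (h1 : (m + 1) * ∫ x, x ^ 2 ∂μ = 1) {u : ℝ}
    (hu : u ∈ Set.Ioo (0 : ℝ) 1) :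
    |quantile (convPow μ (m + 1)) u - quantile (gaussianReal 0 1) u| ≤
      1600 * shiftConst ^ 2 * (2 * (m + 1) * b ^ 2 + 1) * (2 * b) *
        (1 + quantile (gaussianReal 0 1) u ^ 2) := by
  have hI := integrable_id_of_bdd hb
  have hg := measurable_upperMoment (μ := μ)
  set g : ℝ → ℝ := fun t => (m + 1) * upperMoment μ t with hgd
  have hgm : Measurable g := hg.const_mul _
  have hg0 : ∀ t, 0 ≤ g t := fun t => mul_nonneg (by positivity) (upperMoment_nonneg hb h0 t)
  set γ : Measure ℝ := volume.withDensity fun t => ENNReal.ofReal (g t) with hγ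
  have hγ1 : IsProbabilityMeasure γ := by
    constructor
    rw [hγ, withDensity_apply _ MeasurableSet.univ, Measure.restrict_univ,
      ← ofReal_integral_eq_lintegral_ofReal ((integrable_upperMoment hb h0).const_mul _)
        (ae_of_all _ hg0)]
    rw [integral_const_mul, integral_upperMoment hb h0, h1, ENNReal.ofReal_one]
  have hγb : ∀ᵐ t ∂γ, |t| ≤ b := by
    rw [hγ, ae_withDensity_iff hgm.ennreal_ofReal]
    have : ∀ᵐ t : ℝ, t ≠ -b := by simp [ae_iff]
    filter_upwards [this] with t ht hne
    by_contra hc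
    refine hne ?_
    have : t ∉ Set.Ioc (-b) b := fun h => hc (abs_le.2 ⟨h.1.le, h.2⟩)
    simp [hgd, upperMoment_eq_zero hb h0 this ht]
  -- the coordinates are the first `m` summands together, the last one, and its zero-bias version
  set P : Measure (ℝ × (ℝ × ℝ)) := (convPow μ m).prod (μ.prod γ) with hP
  have hPW : P.map (fun z => z.1 + z.2.1) = convPow μ (m + 1) := by
    have e : (fun z : ℝ × (ℝ × ℝ) => z.1 + z.2.1)
        = (fun z : ℝ × ℝ => z.1 + z.2) ∘ (Prod.map id Prod.fst) := rfl
    rw [e, ← Measure.map_map (by fun_prop) (by fun_prop), hP,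
      ← Measure.map_prod_map _ _ measurable_id measurable_fst, Measure.map_id,
      Measure.map_fst_prod, measure_univ, one_smul]
    rfl
  have hPT : P.map (fun z => z.1 + z.2.2) = (convPow μ m).conv γ := by
    have e : (fun z : ℝ × (ℝ × ℝ) => z.1 + z.2.2)
        = (fun z : ℝ × ℝ => z.1 + z.2) ∘ (Prod.map id Prod.snd) := rfl
    rw [e, ← Measure.map_map (by fun_prop) (by fun_prop), hP,
      ← Measure.map_prod_map _ _ measurable_id measurable_snd, Measure.map_id,
      Measure.map_snd_prod, measure_univ, one_smul]
    rfl
  set p : ℝ → ℝ := fun y => ∫ a, g (y - a) ∂(convPow μ m) with hpd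
  have hpe : ∀ x, p x = upperMoment (convPow μ (m + 1)) x := by
    intro x
    rw [upperMoment_convPow hb, hpd]
    simp only [hgd]
    rw [integral_const_mul]
  have hpm : Measurable p := by
    rw [show p = _ from funext hpe]
    exact measurable_upperMoment
  have hpl : P.map (fun z => z.1 + z.2.2) = volume.withDensity fun y => ENNReal.ofReal (p y) := by
    rw [hPT, hγ, conv_withDensity_ofReal hgm hg0]
    intro y
    exact (integrable_upperMoment_comp hI (by fun_prop)).const_mul _
  have hclose : ∀ᵐ z ∂P, |(z.1 + z.2.1) - (z.1 + z.2.2)| ≤ 2 * b := by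
    have q := Measure.quasiMeasurePreserving_snd (μ := convPow μ m) (ν := μ.prod γ)
    have q1 := q.ae (Measure.quasiMeasurePreserving_fst.ae hb)
    have q2 := q.ae (Measure.quasiMeasurePreserving_snd.ae hγb)
    filter_upwards [q1, q2] with z h1 h2
    rw [abs_le] at *
    constructor <;> linarith
  have hWm : Measurable (fun z : ℝ × (ℝ × ℝ) => z.1 + z.2.1) := by fun_prop
  have hTm : Measurable (fun z : ℝ × (ℝ × ℝ) => z.1 + z.2.2) := by fun_prop
  have hWb : ∀ᵐ z ∂P, |z.1 + z.2.1| ≤ ((m + 1 : ℕ) : ℝ) * b := by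
    have := convPow_ae_abs_le hb (m + 1)
    rw [← hPW] at this
    exact ae_of_ae_map hWm.aemeasurable this
  have hW0 : ∫ z, (z.1 + z.2.1) ∂P = 0 := by
    have i1 : Integrable (fun z : ℝ × (ℝ × ℝ) => z.1) P := (integrable_id_convPow hb m).comp_fst _
    have i2 : Integrable (fun z : ℝ × (ℝ × ℝ) => z.2.1) P := (hI.comp_fst γ).comp_snd _
    have hk : ∀ k, ∫ x, x ∂(convPow μ k) = 0 := by
      intro k
      induction k with
      | zero => simp [convPow]
      | succ k ih =>
        have ik := integrable_id_convPow hb k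
        have ik1 := integrable_id_convPow hb (k + 1)
        unfold convPow at ik1 ⊢
        rw [integral_conv ik1]
        have : ∀ x, ∫ y, (x + y) ∂μ = x := by
          intro x
          rw [integral_add (integrable_const x) hI, h0]
          simp
        simp only [this, ih]
    have := integral_map (μ := P) (φ := fun z : ℝ × (ℝ × ℝ) => z.1 + z.2.1) (f := fun x : ℝ => x)
      hWm.aemeasurable measurable_id.aestronglyMeasurable
    rw [← this, hPW, hk]
  have hpW : ∀ x, p x = ∫ z in {z : ℝ × (ℝ × ℝ) | x < z.1 + z.2.1}, (z.1 + z.2.1) ∂P := by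
    intro x
    rw [hpe, upperMoment, ← hPW, setIntegral_map (f := fun s : ℝ => s) measurableSet_Ioi
      measurable_id.aestronglyMeasurable hWm.aemeasurable]
    rfl
  have pair := ZeroBiasPair.of_density hWm hTm (show 0 < 2 * b by positivity) hclose ⟨_, hWb⟩ hW0
    hpm hpW hpl
  have pair' := ZeroBiasPair.of_density_neg hWm hTm (show 0 < 2 * b by positivity) hclose
    ⟨_, hWb⟩ hW0 hpm hpW hpl
  have := pair.abs_quantile_sub_le pair' (M := 2 * (m + 1) * b ^ 2) (by positivity) (by
    filter_upwards [hWb] with z hz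
    refine hz.trans (le_of_eq ?_)
    field_simp
    push_cast
    ring) hu
  rwa [hPW] at this

end Concrete

/-- Given a coupling `ρ` of the law of `V` with another law, a second coordinate can be added to
the space on which `V` lives so that it and `V` are coupled by `ρ`. -/
lemma exists_glue {E : Type} [MeasurableSpace E] (π : Measure E) [IsProbabilityMeasure π]
    {V : E → ℝ} (hV : Measurable V) (ρ : Measure (ℝ × ℝ)) [IsProbabilityMeasure ρ]
    (hρ : ρ.fst = π.map V) :
    ∃ P' : Measure (E × ℝ), IsProbabilityMeasure P' ∧ P'.map Prod.fst = π ∧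
      P'.map (fun ω => (V ω.1, ω.2)) = ρ := by
  refine ⟨π.compProd (ρ.condKernel.comap V hV), inferInstance, ?_, ?_⟩
  · exact Measure.fst_compProd _ _
  · ext s hs
    rw [Measure.map_apply (by fun_prop) hs,
      Measure.compProd_apply (measurableSet_preimage (by fun_prop) hs)]
    conv_rhs => rw [← ρ.disintegrate ρ.condKernel, Measure.compProd_apply hs, hρ]
    rw [lintegral_map (Kernel.measurable_kernel_prodMk_left hs) hV]
    rfl

lemma map_sum_pi (ν : Measure ℝ) [IsProbabilityMeasure ν] (n : ℕ) :
    (Measure.pi fun _ : Fin n => ν).map (fun x => ∑ i, x i) = convPow ν n := by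
  induction n with
  | zero =>
    simp [convPow, Measure.map_const]
  | succ n ih =>
    have h := (measurePreserving_piFinSuccAbove (fun _ : Fin (n + 1) => ν) 0).map_eq
    have e : (fun x : Fin (n + 1) → ℝ => ∑ i, x i)
        = (fun z : ℝ × ℝ => z.1 + z.2) ∘ (Prod.map id fun x : Fin n → ℝ => ∑ i, x i) ∘
          (MeasurableEquiv.piFinSuccAbove (fun _ => ℝ) 0) := by
      funext x
      simp [Fin.sum_univ_succ, MeasurableEquiv.piFinSuccAbove, Fin.insertNthEquiv, Fin.tail]
    rw [e, ← Measure.map_map (by fun_prop) (by fun_prop),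
      ← Measure.map_map (by fun_prop) (by fun_prop), h,
      ← Measure.map_prod_map _ _ measurable_id (by fun_prop), Measure.map_id, ih, convPow,
      Measure.conv_comm]
    rfl

lemma integral_exp_sq_div_four :
    Integrable (fun z : ℝ => Real.exp (z ^ 2 / 4)) (gaussianReal 0 1) ∧
      ∫ z, Real.exp (z ^ 2 / 4) ∂(gaussianReal 0 1) = √2 := by
  have e : ∀ z, gaussianPDFReal 0 1 z * Real.exp (z ^ 2 / 4)
      = (√(2 * Real.pi))⁻¹ * Real.exp (-(1 / 4) * z ^ 2) := by
    intro z
    rw [gaussianPDFReal_std, mul_assoc, ← Real.exp_add]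
    ring_nf
  constructor
  · rw [gaussianReal_of_var_ne_zero 0 one_ne_zero, integrable_withDensity_iff_integrable_smul'
      (measurable_gaussianPDF 0 1) (ae_of_all _ fun _ => gaussianPDF_lt_top)]
    simp only [toReal_gaussianPDF, smul_eq_mul, e]
    exact (integrable_exp_neg_mul_sq (by norm_num)).const_mul _
  · rw [integral_gaussianReal_eq_integral_smul one_ne_zero]
    simp only [smul_eq_mul, e]
    rw [integral_const_mul, integral_gaussian, ← Real.sqrt_inv, ← Real.sqrt_mul (by positivity)]
    congr 1
    field_simp
    norm_num

/-! ### The coupling of the sum with a Gaussian variable -/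

lemma iIndepFun_identDistrib_of_map_eq_pi {Ω Ω' : Type*} [MeasurableSpace Ω] [MeasurableSpace Ω']
    {P : Measure Ω} {P' : Measure Ω'} [IsProbabilityMeasure P] [IsProbabilityMeasure P']
    {ε : Ω → ℝ} (hε : AEMeasurable ε P) {n : ℕ} {X : Fin n → Ω' → ℝ} (hX : ∀ i, Measurable (X i))
    (h : P'.map (fun ω i => X i ω) = Measure.pi fun _ => P.map ε) :
    iIndepFun X P' ∧ ∀ i, IdentDistrib (X i) ε P' P := by
  have := Measure.isProbabilityMeasure_map hε
  have hm : ∀ i, P'.map (X i) = P.map ε := by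
    intro i
    have e : X i = (Function.eval i) ∘ (fun ω i => X i ω) := rfl
    rw [e, ← Measure.map_map (measurable_pi_apply i) (measurable_pi_lambda _ hX), h]
    exact (measurePreserving_eval (fun _ : Fin n => P.map ε) i).map_eq
  refine ⟨?_, fun i => ⟨(hX i).aemeasurable, hε, hm i⟩⟩
  rw [iIndepFun_iff_map_fun_eq_pi_map fun i => (hX i).aemeasurable, h]
  simp only [hm]

/-- The coupling of the coordinate sum with `√(m + 1)` times a standard normal variable, with a
deterministic bound in terms of the latter. -/
lemma exists_coupling {μ : Measure ℝ} [IsProbabilityMeasure μ] {B : ℝ} (hB0 : 0 < B)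
    (hB : ∀ᵐ x ∂μ, |x| ≤ B) (h0 : ∫ x, x ∂μ = 0) (h1 : ∫ x, x ^ 2 ∂μ = 1) (m : ℕ) :
    ∃ P' : Measure ((Fin (m + 1) → ℝ) × ℝ), IsProbabilityMeasure P' ∧
      P'.map Prod.fst = Measure.pi (fun _ => μ) ∧ P'.map Prod.snd = gaussianReal 0 1 ∧
      ∀ᵐ ω ∂P', |(∑ i, ω.1 i) - √((m + 1 : ℕ) : ℝ) * ω.2| ≤
        3200 * shiftConst ^ 2 * (2 * B ^ 2 + 1) * B * (1 + ω.2 ^ 2) := by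
  set r : ℝ := √((m + 1 : ℕ) : ℝ) with hr
  have hr0 : 0 < r := Real.sqrt_pos.2 (by positivity)
  have hr2 : r ^ 2 = m + 1 := by
    rw [hr, Real.sq_sqrt (by positivity)]; push_cast; ring
  set ν : Measure ℝ := μ.map (fun x => x / r) with hν
  have hdm : Measurable fun x : ℝ => x / r := by fun_prop
  have : IsProbabilityMeasure ν := Measure.isProbabilityMeasure_map hdm.aemeasurable
  have hνb : ∀ᵐ x ∂ν, |x| ≤ B / r := by
    rw [hν, ae_map_iff hdm.aemeasurable (measurableSet_le (by fun_prop) (by fun_prop))]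
    filter_upwards [hB] with x hx
    rw [abs_div, abs_of_pos hr0]
    gcongr
  have hν0 : ∫ x, x ∂ν = 0 := by
    rw [hν, integral_map (f := fun x : ℝ => x) hdm.aemeasurable measurable_id.aestronglyMeasurable,
      integral_div, h0, zero_div]
  have hν1 : (m + 1) * ∫ x, x ^ 2 ∂ν = 1 := by
    rw [hν, integral_map (f := fun x : ℝ => x ^ 2) hdm.aemeasurable (by fun_prop)]
    simp only [div_pow]
    rw [integral_div, h1, hr2]
    field_simp
  set V : (Fin (m + 1) → ℝ) → ℝ := fun x => ∑ i, x i / r with hV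
  have hVm : Measurable V := by fun_prop
  have hVl : (Measure.pi fun _ : Fin (m + 1) => μ).map V = convPow ν (m + 1) := by
    rw [← map_sum_pi, hν, ← Measure.pi_map_pi (fun _ => hdm.aemeasurable),
      Measure.map_map (by fun_prop) (by fun_prop)]
    rfl
  set Q : ℝ → ℝ × ℝ := fun u => (quantile (convPow ν (m + 1)) u, quantile (gaussianReal 0 1) u)
    with hQ
  have hQm : AEMeasurable Q (volume.restrict (Set.Ioo 0 1)) :=
    aemeasurable_quantile.prodMk aemeasurable_quantile
  set ρ : Measure (ℝ × ℝ) := (volume.restrict (Set.Ioo 0 1)).map Q with hρ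
  have : IsProbabilityMeasure ρ := Measure.isProbabilityMeasure_map hQm
  have hρ1 : ρ.fst = (Measure.pi fun _ : Fin (m + 1) => μ).map V := by
    rw [hVl, Measure.fst, hρ, AEMeasurable.map_map_of_aemeasurable (by fun_prop) hQm]
    exact map_quantile
  have hρ2 : ρ.snd = gaussianReal 0 1 := by
    rw [Measure.snd, hρ, AEMeasurable.map_map_of_aemeasurable (by fun_prop) hQm]
    exact map_quantile
  have hρ3 : ∀ᵐ z ∂ρ, |z.1 - z.2| ≤ 1600 * shiftConst ^ 2 * (2 * (m + 1) * (B / r) ^ 2 + 1) *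
      (2 * (B / r)) * (1 + z.2 ^ 2) := by
    rw [hρ, ae_map_iff hQm (measurableSet_le (by fun_prop) (by fun_prop))]
    refine (ae_restrict_iff' measurableSet_Ioo).2 (ae_of_all _ fun u hu => ?_)
    exact abs_quantile_convPow_sub_le m (by positivity) hνb hν0 hν1 hu
  obtain ⟨P', hP', e1, e2⟩ := exists_glue _ hVm ρ hρ1
  have hm2 : Measurable fun ω : (Fin (m + 1) → ℝ) × ℝ => (V ω.1, ω.2) := by fun_prop
  refine ⟨P', hP', e1, ?_, ?_⟩
  · rw [← hρ2, ← e2, Measure.snd, Measure.map_map measurable_snd hm2]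
    rfl
  · rw [← e2] at hρ3
    filter_upwards [ae_of_ae_map hm2.aemeasurable hρ3] with ω hω
    have s1 : (∑ i, ω.1 i) - r * ω.2 = r * (V ω.1 - ω.2) := by
      have : V ω.1 = (∑ i, ω.1 i) / r := (Finset.sum_div _ _ _).symm
      rw [this]
      field_simp
    rw [s1, abs_mul, abs_of_pos hr0]
    refine (mul_le_mul_of_nonneg_left hω hr0.le).trans (le_of_eq ?_)
    rw [div_pow, hr2]
    field_simp
    ring

theorem theorem2p1 {Ω : Type*} [MeasurableSpace Ω] (P : Measure Ω) [IsProbabilityMeasure P]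
    (ε : Ω → ℝ) (hε : AEMeasurable ε P)
    (hbdd : ∃ B : ℝ, ∀ᵐ ω ∂P, |ε ω| ≤ B)
    (hmean : ∫ ω, ε ω ∂P = 0)
    (hvar : ProbabilityTheory.variance ε P = 1)
    (hthird : ∫ ω, ε ω ^ 3 ∂P = 0) :
    ∃ θ₁ : ℝ, 0 < θ₁ ∧ ∀ n : ℕ, 1 ≤ n →
      ∃ (Ω' : Type) (_ : MeasurableSpace Ω') (P' : Measure Ω') (_ : IsProbabilityMeasure P')
        (X : Fin n → Ω' → ℝ) (Z : Ω' → ℝ),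
        iIndepFun X P' ∧
        (∀ i, IdentDistrib (X i) ε P' P) ∧
        HasLaw Z (gaussianReal 0 (n : NNReal)) P' ∧
        Integrable (fun ω => Real.exp (θ₁ * |(∑ i, X i ω) - Z ω|)) P' ∧
        ∫ ω, Real.exp (θ₁ * |(∑ i, X i ω) - Z ω|) ∂P' ≤ 8 := by
  obtain ⟨B₀, hB₀⟩ := hbdd
  set μ := P.map ε with hμ
  have : IsProbabilityMeasure μ := Measure.isProbabilityMeasure_map hε
  set B := |B₀| + 1 with hB
  have hBpos : 0 < B := by positivity
  have hμB : ∀ᵐ x ∂μ, |x| ≤ B := by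
    rw [hμ, ae_map_iff hε (measurableSet_le (by fun_prop) (by fun_prop))]
    filter_upwards [hB₀] with ω hω
    linarith [le_abs_self B₀]
  have hμ0 : ∫ x, x ∂μ = 0 := by
    rw [hμ, integral_map (f := fun x : ℝ => x) hε measurable_id.aestronglyMeasurable, hmean]
  have hμ1 : ∫ x, x ^ 2 ∂μ = 1 := by
    rw [hμ, integral_map (f := fun x : ℝ => x ^ 2) hε (by fun_prop), ← hvar,
      variance_of_integral_eq_zero hε hmean]
  have hC := shiftConst_ge
  have hC0 : 0 < shiftConst := by linarith [berryEsseenConst_pos]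
  set K := 3200 * shiftConst ^ 2 * (2 * B ^ 2 + 1) * B with hK
  have hK0 : 0 < K := by positivity
  -- this makes the exponent at most `(1 + z²) / 4`, whose exponential is integrable for a
  -- standard normal `z`
  refine ⟨1 / (4 * K), by positivity, fun n hn => ?_⟩
  obtain ⟨m, rfl⟩ : ∃ m, n = m + 1 := ⟨n - 1, by omega⟩
  obtain ⟨P', hP', e1, e2, e3⟩ := exists_coupling hBpos hμB hμ0 hμ1 m
  obtain ⟨hind, hid⟩ := iIndepFun_identDistrib_of_map_eq_pi (P' := P') hε
    (X := fun i ω => ω.1 i) (fun i => by fun_prop) e1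
  have hsnd : HasLaw (fun ω : (Fin (m + 1) → ℝ) × ℝ => ω.2) (gaussianReal 0 1) P' :=
    ⟨measurable_snd.aemeasurable, e2⟩
  obtain ⟨g1, g2⟩ := integral_exp_sq_div_four
  have i1 : Integrable (fun ω : (Fin (m + 1) → ℝ) × ℝ =>
      Real.exp (1 / 4) * Real.exp (ω.2 ^ 2 / 4)) P' := by
    rw [← e2] at g1
    exact (g1.comp_measurable measurable_snd).const_mul _
  have hle : ∀ᵐ ω ∂P', Real.exp (1 / (4 * K) *
      |(∑ i, ω.1 i) - √((m + 1 : ℕ) : ℝ) * ω.2|) ≤ Real.exp (1 / 4) * Real.exp (ω.2 ^ 2 / 4) := by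
    filter_upwards [e3] with ω hω
    rw [← Real.exp_add]
    refine Real.exp_le_exp.2 ?_
    have := mul_le_mul_of_nonneg_left hω (show 0 ≤ 1 / (4 * K) by positivity)
    refine this.trans (le_of_eq ?_)
    rw [← hK]
    field_simp
  have i2 : Integrable (fun ω : (Fin (m + 1) → ℝ) × ℝ => Real.exp (1 / (4 * K) *
      |(∑ i, ω.1 i) - √((m + 1 : ℕ) : ℝ) * ω.2|)) P' := by
    refine i1.mono' (by fun_prop) ?_
    filter_upwards [hle] with ω hω
    rwa [Real.norm_eq_abs, Real.abs_exp]
  refine ⟨(Fin (m + 1) → ℝ) × ℝ, inferInstance, P', hP', fun i ω => ω.1 i,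
    fun ω => √((m + 1 : ℕ) : ℝ) * ω.2, hind, hid, ?_, i2, ?_⟩
  · have := gaussianReal_const_mul hsnd √((m + 1 : ℕ) : ℝ)
    convert this using 2
    · simp
    · ext
      simp [Real.sq_sqrt (show (0 : ℝ) ≤ (m : ℝ) + 1 by positivity)]
  · refine (integral_mono_ae i2 i1 hle).trans ?_
    have e4 : ∫ ω, Real.exp (ω.2 ^ 2 / 4) ∂P' = √2 := by
      rw [← g2, ← e2, integral_map measurable_snd.aemeasurable (by fun_prop)]
    rw [integral_const_mul, e4]
    have h1 : Real.exp (1 / 4) ≤ 4 := by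
      have := Real.exp_le_exp.2 (show (1 / 4 : ℝ) ≤ 1 by norm_num)
      linarith [Real.exp_one_lt_d9]
    have h2 : √2 ≤ 2 := by
      rw [Real.sqrt_le_left (by norm_num)]; norm_num
    calc Real.exp (1 / 4) * √2 ≤ 4 * 2 := mul_le_mul h1 h2 (Real.sqrt_nonneg 2) (by norm_num)
      _ = 8 := by norm_num
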